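/- Let $\mathrm{ITT}$ be intensional Martin-Löf type theory with $\Pi$ types, $\Sigma$ types, intensional identity types, binary coproduct types, an empty type, a unit type, and one universe $\mathcal U$ closed under all of these type formers, with strict (judgmental) $\beta$ rules for all type formers and strict $\eta$ rules for $\Pi$ types, $\Sigma$ types and the unit type. Notation in $\mathrm{ITT}$. For $f,g:\prod_{a:A}B(a)$ write $f\sim g :\equiv \prod_{a:A} (f(a)=_{B(a)}g(a))$. For $f:A\to B$ put $$\mathrm{isEquiv}(f):\equiv\Big(\sum_{s:B\to A} f\circ s\sim \mathrm{id}_B\Big)\times\Big(\sum_{r:B\to A} r\circ f\sim \mathrm{id}_A\Big),\qquad \mathrm{isCEq}(f):\equiv\Big(\sum_{s:B\to A} f\circ s= \mathrm{id}_B\Big)\times\Big(\sum_{r:B\to A} r\circ f= \mathrm{id}_A\Big),$$ $(A\simeq B):\equiv\sum_{f:A\to B}\mathrm{isEquiv}(f)$ (homotopy equivalences) and $(A\cong B):\equiv\sum_{f:A\to B}\mathrm{isCEq}(f)$ (categorical equivalences). Let $\mathrm{happly}:(f=g)\to(f\sim g)$ be the map defined by path induction, sending $\mathrm{refl}$ to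 $\lambda a.\,\mathrm{refl}_{f(a)}$, and let $\Phi_{A,B}:(A\cong B)\to(A\simeq B)$ be the map $(f,(s,p),(r,q))\mapsto(f,(s,\mathrm{happly}(p)),(r,\mathrm{happly}(q)))$. A homotopy section of $\varphi:X\to Y$ is a map $s:Y\to X$ with $\varphi\circ s\sim\mathrm{id}_Y$. A type $T$ is a proposition if $\prod_{x,y:T}x=y$, and contractible if $\sum_{c:T}\prod_{x:T}c=x$. For $f:A\to B$ and a type $Z$, $f_*:(Z\to A)\to(Z\to B)$ is post-composition with $f$. Theorem. In $\mathrm{ITT}$ the following eight principles are logically equivalent: 1. (Equivalence improvement) for all types $A,B$, the map $\Phi_{A,B}:(A\cong B)\to(A\simeq B)$ is an equivalence; 2. for all types $A,B$, the map $\Phi_{A,B}$ admits a homotopy section; 3. for all types $A,B$ and every $f:A\to B$, the type $\mathrm{isEquiv}(f)$ is a proposition; 4. for every type $A$ and every $f:A\to A$, if $f\sim\mathrm{id}_A$ then $f=\mathrm{id}_A$; 5. for all types $A,B$ and every $f:A\to B$, $\mathrm{isEquiv}(f)\to\mathrm{isCEq}(f)$; 6. for all types $A,B,Z$ and every $f:A\to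 B$, $\mathrm{isEquiv}(f)\to\mathrm{isEquiv}(f_*)$, where $f_*:(Z\to A)\to(Z\to B)$; 7. (Weak function extensionality) for every family of contractible types $a:A\vdash P(a)$, the type $\prod_{a:A}P(a)$ is contractible; 8. (Function extensionality) for every family $a:A\vdash B(a)$ and $f,g:\prod_{a:A}B(a)$, the map $\mathrm{happly}:(f=g)\to(f\sim g)$ is an equivalence. Here "types" are arbitrary, possibly large, types in an arbitrary context, so each principle is a scheme; logical equivalence means that in every extension $T$ of $\mathrm{ITT}$ by postulated inhabitants of a substitution-closed class of types, if $T$ proves (inhabits in context) all instances of one of the principles, then $T$ proves all instances of each of the others. -/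

import Mathlib

namespace ITT

/-! ## Raw expressions

Types and terms share one grammar (de Bruijn indices, index `0` is the innermost variable).
The universe is à la Russell: an element of `univ` is itself a type. -/

/-- Raw expressions. The number of variables bound in an argument is noted where it is not zero.
`post T` is a postulated element of the type `T`; it is only typable when `T` belongs to the
scheme of postulates under consideration. -/
inductive Raw : Type
  | var (n : ℕ)
  | univ
  /-- `Π (x : A), B`, where `B` binds 1 -/
  | pi (A B : Raw)
  /-- `λ x, b`, where `b` binds 1 -/
  | lam (b : Raw)
  | app (f a : Raw)
  /-- `Σ (x : A), B`, where `B` binds 1 -/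
  | sigma (A B : Raw)
  | pair (a b : Raw)
  | fst (p : Raw)
  | snd (p : Raw)
  /-- the identity type `a =_A b` -/
  | idt (A a b : Raw)
  | refl (a : Raw)
  /-- path induction; the motive `C` binds 2 (the free endpoint and the path) -/
  | elimId (C d p : Raw)
  | sum (A B : Raw)
  | inl (a : Raw)
  | inr (b : Raw)
  /-- case distinction; the motive `C` and the branches `l`, `r` bind 1 -/
  | elimSum (C l r s : Raw)
  | empty
  /-- elimination from the empty type; the motive `C` binds 1 -/
  | elimEmpty (C s : Raw)
  | unit
  | star
  | post (T : Raw)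

/-- Lift a renaming under one binder. -/
def liftRen (ρ : ℕ → ℕ) : ℕ → ℕ
  | 0 => 0
  | n + 1 => ρ n + 1

namespace Raw

/-- Renaming of free variables. -/
def rename : Raw → (ℕ → ℕ) → Raw
  | var n, ρ => var (ρ n)
  | univ, _ => univ
  | pi A B, ρ => pi (A.rename ρ) (B.rename (liftRen ρ))
  | lam b, ρ => lam (b.rename (liftRen ρ))
  | app f a, ρ => app (f.rename ρ) (a.rename ρ)
  | sigma A B, ρ => sigma (A.rename ρ) (B.rename (liftRen ρ))
  | pair a b, ρ => pair (a.rename ρ) (b.rename ρ)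
  | fst p, ρ => fst (p.rename ρ)
  | snd p, ρ => snd (p.rename ρ)
  | idt A a b, ρ => idt (A.rename ρ) (a.rename ρ) (b.rename ρ)
  | refl a, ρ => refl (a.rename ρ)
  | elimId C d p, ρ => elimId (C.rename (liftRen (liftRen ρ))) (d.rename ρ) (p.rename ρ)
  | sum A B, ρ => sum (A.rename ρ) (B.rename ρ)
  | inl a, ρ => inl (a.rename ρ)
  | inr b, ρ => inr (b.rename ρ)
  | elimSum C l r s, ρ =>
      elimSum (C.rename (liftRen ρ)) (l.rename (liftRen ρ)) (r.rename (liftRen ρ)) (s.rename ρ)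
  | empty, _ => empty
  | elimEmpty C s, ρ => elimEmpty (C.rename (liftRen ρ)) (s.rename ρ)
  | unit, _ => unit
  | star, _ => star
  | post T, ρ => post (T.rename ρ)

/-- Weakening by one variable. -/
def wk (t : Raw) : Raw := t.rename (· + 1)

end Raw

open Raw

/-- Lift a substitution under one binder. -/
def liftSub (σ : ℕ → Raw) : ℕ → Raw
  | 0 => var 0
  | n + 1 => (σ n).wk

/-- Extend a substitution by a value for the innermost variable. -/
def consSub (a : Raw) (σ : ℕ → Raw) : ℕ → Raw
  | 0 => a
  | n + 1 => σ n

namespace Raw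

/-- Simultaneous capture-avoiding substitution. -/
def subst : Raw → (ℕ → Raw) → Raw
  | var n, σ => σ n
  | univ, _ => univ
  | pi A B, σ => pi (A.subst σ) (B.subst (liftSub σ))
  | lam b, σ => lam (b.subst (liftSub σ))
  | app f a, σ => app (f.subst σ) (a.subst σ)
  | sigma A B, σ => sigma (A.subst σ) (B.subst (liftSub σ))
  | pair a b, σ => pair (a.subst σ) (b.subst σ)
  | fst p, σ => fst (p.subst σ)
  | snd p, σ => snd (p.subst σ)
  | idt A a b, σ => idt (A.subst σ) (a.subst σ) (b.subst σ)
  | refl a, σ => refl (a.subst σ)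
  | elimId C d p, σ => elimId (C.subst (liftSub (liftSub σ))) (d.subst σ) (p.subst σ)
  | sum A B, σ => sum (A.subst σ) (B.subst σ)
  | inl a, σ => inl (a.subst σ)
  | inr b, σ => inr (b.subst σ)
  | elimSum C l r s, σ =>
      elimSum (C.subst (liftSub σ)) (l.subst (liftSub σ)) (r.subst (liftSub σ)) (s.subst σ)
  | empty, _ => empty
  | elimEmpty C s, σ => elimEmpty (C.subst (liftSub σ)) (s.subst σ)
  | unit, _ => unit
  | star, _ => star
  | post T, σ => post (T.subst σ)

/-- `B[a]`: replace the innermost variable. -/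
def inst (B a : Raw) : Raw := B.subst (consSub a var)

/-- `C[b, p]`: replace variable `1` by `b` and variable `0` by `p`. -/
def inst₂ (C b p : Raw) : Raw := C.subst (consSub p (consSub b var))

/-- `C[inl x]` in the context extended by `x` (variable `0` of the result). -/
def substInl (C : Raw) : Raw := C.subst (consSub (inl (var 0)) fun n => var (n + 1))

/-- `C[inr y]` in the context extended by `y` (variable `0` of the result). -/
def substInr (C : Raw) : Raw := C.subst (consSub (inr (var 0)) fun n => var (n + 1))

end Raw

/-! ## Judgments and rules -/

/-- Contexts; the innermost variable comes first, each type lives in the context of its tail. -/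
abbrev Ctx := List Raw

/-- `Lookup Γ n A`: the variable with index `n` has type `A` in `Γ`. -/
inductive Lookup : Ctx → ℕ → Raw → Prop
  | zero (Γ : Ctx) (A : Raw) : Lookup (A :: Γ) 0 A.wk
  | succ (Γ : Ctx) (n : ℕ) (A B : Raw) : Lookup Γ n A → Lookup (B :: Γ) (n + 1) A.wk

/-- The five forms of judgment. -/
inductive Judgment : Type
  /-- `⊢ Γ` -/
  | ctx (Γ : Ctx)
  /-- `Γ ⊢ A type` -/
  | ty (Γ : Ctx) (A : Raw)
  /-- `Γ ⊢ A ≡ B type` -/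
  | tyEq (Γ : Ctx) (A B : Raw)
  /-- `Γ ⊢ a : A` -/
  | tm (Γ : Ctx) (a A : Raw)
  /-- `Γ ⊢ a ≡ b : A` -/
  | tmEq (Γ : Ctx) (a b A : Raw)

open Judgment

/-- A scheme of postulates by which the theory is extended: a class of types closed under
substitution. Every well-formed type in the class is postulated to be inhabited, in every
context. -/
structure Scheme where
  mem : Raw → Prop
  mem_subst : ∀ (T : Raw) (σ : ℕ → Raw), mem T → mem (T.subst σ)

/-- `Der X J`: the judgment `J` is derivable in intensional Martin-Löf type theory extended by the
postulates `X`. -/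
inductive Der (X : Scheme) : Judgment → Prop
  -- contexts
  | ctx_nil : Der X (ctx [])
  | ctx_cons {Γ A} : Der X (ctx Γ) → Der X (ty Γ A) → Der X (ctx (A :: Γ))
  -- structural rules
  | var {Γ n A} : Der X (ctx Γ) → Lookup Γ n A → Der X (tm Γ (var n) A)
  | conv {Γ a A B} : Der X (tm Γ a A) → Der X (tyEq Γ A B) → Der X (tm Γ a B)
  | conv_eq {Γ a b A B} : Der X (tmEq Γ a b A) → Der X (tyEq Γ A B) → Der X (tmEq Γ a b B)
  | ty_refl {Γ A} : Der X (ty Γ A) → Der X (tyEq Γ A A)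
  | ty_symm {Γ A B} : Der X (tyEq Γ A B) → Der X (tyEq Γ B A)
  | ty_trans {Γ A B C} : Der X (tyEq Γ A B) → Der X (tyEq Γ B C) → Der X (tyEq Γ A C)
  | tm_refl {Γ a A} : Der X (tm Γ a A) → Der X (tmEq Γ a a A)
  | tm_symm {Γ a b A} : Der X (tmEq Γ a b A) → Der X (tmEq Γ b a A)
  | tm_trans {Γ a b c A} : Der X (tmEq Γ a b A) → Der X (tmEq Γ b c A) → Der X (tmEq Γ a c A)
  -- dependent products
  | pi_form {Γ A B} : Der X (ty Γ A) → Der X (ty (A :: Γ) B) → Der X (ty Γ (pi A B))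
  | pi_form_eq {Γ A A' B B'} : Der X (ty Γ A) → Der X (tyEq Γ A A') → Der X (tyEq (A :: Γ) B B') →
      Der X (tyEq Γ (pi A B) (pi A' B'))
  | lam {Γ A B b} : Der X (ty Γ A) → Der X (tm (A :: Γ) b B) → Der X (tm Γ (lam b) (pi A B))
  | lam_eq {Γ A B b b'} : Der X (ty Γ A) → Der X (tmEq (A :: Γ) b b' B) →
      Der X (tmEq Γ (lam b) (lam b') (pi A B))
  | app {Γ A B f a} : Der X (tm Γ f (pi A B)) → Der X (tm Γ a A) →
      Der X (tm Γ (app f a) (B.inst a))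
  | app_eq {Γ A B f f' a a'} : Der X (tmEq Γ f f' (pi A B)) → Der X (tmEq Γ a a' A) →
      Der X (tmEq Γ (app f a) (app f' a') (B.inst a))
  | pi_beta {Γ A B b a} : Der X (ty Γ A) → Der X (tm (A :: Γ) b B) → Der X (tm Γ a A) →
      Der X (tmEq Γ (app (lam b) a) (b.inst a) (B.inst a))
  | pi_eta {Γ A B f} : Der X (tm Γ f (pi A B)) →
      Der X (tmEq Γ f (lam (app f.wk (var 0))) (pi A B))
  -- dependent sums
  | sigma_form {Γ A B} : Der X (ty Γ A) → Der X (ty (A :: Γ) B) → Der X (ty Γ (sigma A B))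
  | sigma_form_eq {Γ A A' B B'} : Der X (ty Γ A) → Der X (tyEq Γ A A') →
      Der X (tyEq (A :: Γ) B B') → Der X (tyEq Γ (sigma A B) (sigma A' B'))
  | pair {Γ A B a b} : Der X (ty Γ A) → Der X (ty (A :: Γ) B) → Der X (tm Γ a A) →
      Der X (tm Γ b (B.inst a)) → Der X (tm Γ (pair a b) (sigma A B))
  | pair_eq {Γ A B a a' b b'} : Der X (ty Γ A) → Der X (ty (A :: Γ) B) → Der X (tmEq Γ a a' A) →
      Der X (tmEq Γ b b' (B.inst a)) → Der X (tmEq Γ (pair a b) (pair a' b') (sigma A B))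
  | fst {Γ A B p} : Der X (tm Γ p (sigma A B)) → Der X (tm Γ (fst p) A)
  | fst_eq {Γ A B p p'} : Der X (tmEq Γ p p' (sigma A B)) → Der X (tmEq Γ (fst p) (fst p') A)
  | snd {Γ A B p} : Der X (tm Γ p (sigma A B)) → Der X (tm Γ (snd p) (B.inst (fst p)))
  | snd_eq {Γ A B p p'} : Der X (tmEq Γ p p' (sigma A B)) →
      Der X (tmEq Γ (snd p) (snd p') (B.inst (fst p)))
  | fst_beta {Γ A B a b} : Der X (ty Γ A) → Der X (ty (A :: Γ) B) → Der X (tm Γ a A) →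
      Der X (tm Γ b (B.inst a)) → Der X (tmEq Γ (fst (pair a b)) a A)
  | snd_beta {Γ A B a b} : Der X (ty Γ A) → Der X (ty (A :: Γ) B) → Der X (tm Γ a A) →
      Der X (tm Γ b (B.inst a)) → Der X (tmEq Γ (snd (pair a b)) b (B.inst a))
  | sigma_eta {Γ A B p} : Der X (tm Γ p (sigma A B)) →
      Der X (tmEq Γ p (pair (fst p) (snd p)) (sigma A B))
  -- identity types
  | id_form {Γ A a b} : Der X (ty Γ A) → Der X (tm Γ a A) → Der X (tm Γ b A) →
      Der X (ty Γ (idt A a b))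
  | id_form_eq {Γ A A' a a' b b'} : Der X (tyEq Γ A A') → Der X (tmEq Γ a a' A) →
      Der X (tmEq Γ b b' A) → Der X (tyEq Γ (idt A a b) (idt A' a' b'))
  | refl {Γ A a} : Der X (tm Γ a A) → Der X (tm Γ (refl a) (idt A a a))
  | refl_eq {Γ A a a'} : Der X (tmEq Γ a a' A) → Der X (tmEq Γ (refl a) (refl a') (idt A a a))
  | elimId {Γ A a b C d p} : Der X (ty Γ A) → Der X (tm Γ a A) →
      Der X (ty (idt A.wk a.wk (var 0) :: A :: Γ) C) → Der X (tm Γ d (C.inst₂ a (refl a))) →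
      Der X (tm Γ b A) → Der X (tm Γ p (idt A a b)) →
      Der X (tm Γ (elimId C d p) (C.inst₂ b p))
  | elimId_eq {Γ A a b C C' d d' p p'} : Der X (ty Γ A) → Der X (tm Γ a A) →
      Der X (tyEq (idt A.wk a.wk (var 0) :: A :: Γ) C C') →
      Der X (tmEq Γ d d' (C.inst₂ a (refl a))) →
      Der X (tm Γ b A) → Der X (tmEq Γ p p' (idt A a b)) →
      Der X (tmEq Γ (elimId C d p) (elimId C' d' p') (C.inst₂ b p))
  | id_beta {Γ A a C d} : Der X (ty Γ A) → Der X (tm Γ a A) →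
      Der X (ty (idt A.wk a.wk (var 0) :: A :: Γ) C) → Der X (tm Γ d (C.inst₂ a (refl a))) →
      Der X (tmEq Γ (elimId C d (refl a)) d (C.inst₂ a (refl a)))
  -- binary coproducts
  | sum_form {Γ A B} : Der X (ty Γ A) → Der X (ty Γ B) → Der X (ty Γ (sum A B))
  | sum_form_eq {Γ A A' B B'} : Der X (tyEq Γ A A') → Der X (tyEq Γ B B') →
      Der X (tyEq Γ (sum A B) (sum A' B'))
  | inl {Γ A B a} : Der X (tm Γ a A) → Der X (ty Γ B) → Der X (tm Γ (inl a) (sum A B))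
  | inl_eq {Γ A B a a'} : Der X (tmEq Γ a a' A) → Der X (ty Γ B) →
      Der X (tmEq Γ (inl a) (inl a') (sum A B))
  | inr {Γ A B b} : Der X (ty Γ A) → Der X (tm Γ b B) → Der X (tm Γ (inr b) (sum A B))
  | inr_eq {Γ A B b b'} : Der X (ty Γ A) → Der X (tmEq Γ b b' B) →
      Der X (tmEq Γ (inr b) (inr b') (sum A B))
  | elimSum {Γ A B C l r s} : Der X (ty Γ A) → Der X (ty Γ B) → Der X (ty (sum A B :: Γ) C) →
      Der X (tm (A :: Γ) l C.substInl) → Der X (tm (B :: Γ) r C.substInr) →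
      Der X (tm Γ s (sum A B)) → Der X (tm Γ (elimSum C l r s) (C.inst s))
  | elimSum_eq {Γ A B C C' l l' r r' s s'} : Der X (ty Γ A) → Der X (ty Γ B) →
      Der X (tyEq (sum A B :: Γ) C C') → Der X (tmEq (A :: Γ) l l' C.substInl) →
      Der X (tmEq (B :: Γ) r r' C.substInr) → Der X (tmEq Γ s s' (sum A B)) →
      Der X (tmEq Γ (elimSum C l r s) (elimSum C' l' r' s') (C.inst s))
  | inl_beta {Γ A B C l r a} : Der X (ty Γ A) → Der X (ty Γ B) → Der X (ty (sum A B :: Γ) C) →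
      Der X (tm (A :: Γ) l C.substInl) → Der X (tm (B :: Γ) r C.substInr) → Der X (tm Γ a A) →
      Der X (tmEq Γ (elimSum C l r (inl a)) (l.inst a) (C.inst (inl a)))
  | inr_beta {Γ A B C l r b} : Der X (ty Γ A) → Der X (ty Γ B) → Der X (ty (sum A B :: Γ) C) →
      Der X (tm (A :: Γ) l C.substInl) → Der X (tm (B :: Γ) r C.substInr) → Der X (tm Γ b B) →
      Der X (tmEq Γ (elimSum C l r (inr b)) (r.inst b) (C.inst (inr b)))
  -- empty type
  | empty_form {Γ} : Der X (ctx Γ) → Der X (ty Γ empty)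
  | elimEmpty {Γ C s} : Der X (ty (empty :: Γ) C) → Der X (tm Γ s empty) →
      Der X (tm Γ (elimEmpty C s) (C.inst s))
  | elimEmpty_eq {Γ C C' s s'} : Der X (tyEq (empty :: Γ) C C') → Der X (tmEq Γ s s' empty) →
      Der X (tmEq Γ (elimEmpty C s) (elimEmpty C' s') (C.inst s))
  -- unit type; its eliminator is derivable from the eta rule
  | unit_form {Γ} : Der X (ctx Γ) → Der X (ty Γ unit)
  | star {Γ} : Der X (ctx Γ) → Der X (tm Γ star unit)
  | unit_eta {Γ a} : Der X (tm Γ a unit) → Der X (tmEq Γ a star unit)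
  -- universe
  | univ_form {Γ} : Der X (ctx Γ) → Der X (ty Γ univ)
  | el {Γ A} : Der X (tm Γ A univ) → Der X (ty Γ A)
  | el_eq {Γ A B} : Der X (tmEq Γ A B univ) → Der X (tyEq Γ A B)
  | univ_pi {Γ A B} : Der X (tm Γ A univ) → Der X (tm (A :: Γ) B univ) →
      Der X (tm Γ (pi A B) univ)
  | univ_pi_eq {Γ A A' B B'} : Der X (tm Γ A univ) → Der X (tmEq Γ A A' univ) →
      Der X (tmEq (A :: Γ) B B' univ) → Der X (tmEq Γ (pi A B) (pi A' B') univ)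
  | univ_sigma {Γ A B} : Der X (tm Γ A univ) → Der X (tm (A :: Γ) B univ) →
      Der X (tm Γ (sigma A B) univ)
  | univ_sigma_eq {Γ A A' B B'} : Der X (tm Γ A univ) → Der X (tmEq Γ A A' univ) →
      Der X (tmEq (A :: Γ) B B' univ) → Der X (tmEq Γ (sigma A B) (sigma A' B') univ)
  | univ_id {Γ A a b} : Der X (tm Γ A univ) → Der X (tm Γ a A) → Der X (tm Γ b A) →
      Der X (tm Γ (idt A a b) univ)
  | univ_id_eq {Γ A A' a a' b b'} : Der X (tmEq Γ A A' univ) → Der X (tmEq Γ a a' A) →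
      Der X (tmEq Γ b b' A) → Der X (tmEq Γ (idt A a b) (idt A' a' b') univ)
  | univ_sum {Γ A B} : Der X (tm Γ A univ) → Der X (tm Γ B univ) → Der X (tm Γ (sum A B) univ)
  | univ_sum_eq {Γ A A' B B'} : Der X (tmEq Γ A A' univ) → Der X (tmEq Γ B B' univ) →
      Der X (tmEq Γ (sum A B) (sum A' B') univ)
  | univ_empty {Γ} : Der X (ctx Γ) → Der X (tm Γ empty univ)
  | univ_unit {Γ} : Der X (ctx Γ) → Der X (tm Γ unit univ)
  -- postulates
  | post {Γ T} : X.mem T → Der X (ty Γ T) → Der X (tm Γ (post T) T)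
  | post_eq {Γ T T'} : X.mem T → X.mem T' → Der X (tyEq Γ T T') →
      Der X (tmEq Γ (post T) (post T') T)

/-- The type `T` is inhabited in context `Γ`. -/
def Inhabited (X : Scheme) (Γ : Ctx) (T : Raw) : Prop := ∃ t, Der X (tm Γ t T)

/-! ## Notions defined inside the theory -/

/-- The function type `A → B`. -/
def arr (A B : Raw) : Raw := pi A B.wk

/-- The product type `A × B`. -/
def prod (A B : Raw) : Raw := sigma A B.wk

/-- The identity function. -/
def idFun : Raw := lam (var 0)

/-- The composite `g ∘ f`. -/
def comp (g f : Raw) : Raw := lam (app g.wk (app f.wk (var 0)))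

/-- Post-composition `f_* : (Z → A) → (Z → B)` with `f : A → B`. -/
def postComp (f : Raw) : Raw := lam (comp f.wk (var 0))

/-- The type `f ∼ g` of homotopies, for `f, g : Π (a : A), B a` (where `B` binds 1). -/
def htpy (A B f g : Raw) : Raw := pi A (idt B (app f.wk (var 0)) (app g.wk (var 0)))

/-- Homotopy sections of `f : A → B`: maps `s : B → A` with `f ∘ s ∼ id`. -/
def hSec (A B f : Raw) : Raw :=
  sigma (arr B A) (htpy B.wk B.wk.wk (comp f.wk (var 0)) idFun)

/-- Homotopy retractions of `f : A → B`: maps `r : B → A` with `r ∘ f ∼ id`. -/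
def hRet (A B f : Raw) : Raw :=
  sigma (arr B A) (htpy A.wk A.wk.wk (comp (var 0) f.wk) idFun)

/-- `isEquiv f` for `f : A → B`. -/
def isEquiv (A B f : Raw) : Raw := prod (hSec A B f) (hRet A B f)

/-- The type `A ≃ B` of homotopy equivalences. -/
def hEquiv (A B : Raw) : Raw := sigma (arr A B) (isEquiv A.wk B.wk (var 0))

/-- Sections of `f : A → B`: maps `s : B → A` with `f ∘ s = id`. -/
def cSec (A B f : Raw) : Raw :=
  sigma (arr B A) (idt (arr B B).wk (comp f.wk (var 0)) idFun)

/-- Retractions of `f : A → B`: maps `r : B → A` with `r ∘ f = id`. -/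
def cRet (A B f : Raw) : Raw :=
  sigma (arr B A) (idt (arr A A).wk (comp (var 0) f.wk) idFun)

/-- `isCEq f` for `f : A → B`. -/
def isCEq (A B f : Raw) : Raw := prod (cSec A B f) (cRet A B f)

/-- The type `A ≅ B` of categorical equivalences. -/
def cEquiv (A B : Raw) : Raw := sigma (arr A B) (isCEq A.wk B.wk (var 0))

/-- The map `(f = g) → (f ∼ g)` for `f, g : Π (a : A), B a`, defined by path induction from the
constant homotopy `λ a, refl (f a)`. The endpoint `g` does not occur in the term. -/
def happly (A B f : Raw) : Raw :=
  lam (elimId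
    (htpy (A.rename (· + 3)) (B.rename (liftRen (· + 3))) (f.rename (· + 3)) (var 1))
    (lam (refl (app f.wk.wk (var 0))))
    (var 0))

/-- The map `(A ≅ B) → (A ≃ B)`, sending `(f, (s, p), (r, q))` to
`(f, (s, happly p), (r, happly q))`. -/
def cEquivToHEquiv (A B : Raw) : Raw :=
  let f := fst (var 0)
  let s := fst (fst (snd (var 0)))
  let p := snd (fst (snd (var 0)))
  let r := fst (snd (snd (var 0)))
  let q := snd (snd (snd (var 0)))
  lam (pair f (pair
    (pair s (app (happly B.wk B.wk.wk (comp f s)) p))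
    (pair r (app (happly A.wk A.wk.wk (comp r f)) q))))

/-- `T` is a proposition: any two of its elements are equal. -/
def isProp (T : Raw) : Raw := pi T (pi T.wk (idt T.wk.wk (var 1) (var 0)))

/-- `T` is contractible. -/
def isContr (T : Raw) : Raw := sigma T (pi T.wk (idt T.wk.wk (var 1) (var 0)))

/-! ## The principles

Each one quantifies over all contexts and all well-formed data in them, and asserts that the
resulting type is inhabited in the theory extended by `X`. -/

/-- Equivalence improvement: `(A ≅ B) → (A ≃ B)` is an equivalence. -/
def EquivImprovement (X : Scheme) : Prop :=
  ∀ (Γ : Ctx) (A B : Raw), Der X (ty Γ A) → Der X (ty Γ B) →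
    Inhabited X Γ (isEquiv (cEquiv A B) (hEquiv A B) (cEquivToHEquiv A B))

/-- `(A ≅ B) → (A ≃ B)` has a homotopy section. -/
def EquivImprovementSection (X : Scheme) : Prop :=
  ∀ (Γ : Ctx) (A B : Raw), Der X (ty Γ A) → Der X (ty Γ B) →
    Inhabited X Γ (hSec (cEquiv A B) (hEquiv A B) (cEquivToHEquiv A B))

/-- `isEquiv f` is a proposition. -/
def IsEquivIsProp (X : Scheme) : Prop :=
  ∀ (Γ : Ctx) (A B f : Raw), Der X (ty Γ A) → Der X (ty Γ B) → Der X (tm Γ f (arr A B)) →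
    Inhabited X Γ (isProp (isEquiv A B f))

/-- For `f : A → A`, if `f ∼ id` then `f = id`. -/
def HtpyIdToEqId (X : Scheme) : Prop :=
  ∀ (Γ : Ctx) (A f : Raw), Der X (ty Γ A) → Der X (tm Γ f (arr A A)) →
    Inhabited X Γ (arr (htpy A A.wk f idFun) (idt (arr A A) f idFun))

/-- `isEquiv f → isCEq f`. -/
def IsEquivToIsCEq (X : Scheme) : Prop :=
  ∀ (Γ : Ctx) (A B f : Raw), Der X (ty Γ A) → Der X (ty Γ B) → Der X (tm Γ f (arr A B)) →
    Inhabited X Γ (arr (isEquiv A B f) (isCEq A B f))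

/-- `isEquiv f → isEquiv f_*`, where `f_* : (Z → A) → (Z → B)` for an arbitrary type `Z`. -/
def IsEquivPostComp (X : Scheme) : Prop :=
  ∀ (Γ : Ctx) (A B Z f : Raw), Der X (ty Γ A) → Der X (ty Γ B) → Der X (ty Γ Z) →
    Der X (tm Γ f (arr A B)) →
    Inhabited X Γ (arr (isEquiv A B f) (isEquiv (arr Z A) (arr Z B) (postComp f)))

/-- Weak function extensionality: a product of contractible types is contractible. -/
def WeakFunExt (X : Scheme) : Prop :=
  ∀ (Γ : Ctx) (A P : Raw), Der X (ty Γ A) → Der X (ty (A :: Γ) P) →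
    Inhabited X Γ (arr (pi A (isContr P)) (isContr (pi A P)))

/-- Function extensionality: `(f = g) → (f ∼ g)` is an equivalence. -/
def FunExt (X : Scheme) : Prop :=
  ∀ (Γ : Ctx) (A B f g : Raw), Der X (ty Γ A) → Der X (ty (A :: Γ) B) →
    Der X (tm Γ f (pi A B)) → Der X (tm Γ g (pi A B)) →
    Inhabited X Γ (isEquiv (idt (pi A B) f g) (htpy A B f g) (happly A B f))

end ITT

/-! The hub is `HtpyIdToEqId`: an endomap homotopic to the identity is equal to it. Every other
principle implies it, directly or through a chain, and it implies every other one.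

Into the hub. Let `H : f ∼ id`. The identity of `A` is then an equivalence with section `f`. If `Φ`
has a section, a preimage of this equivalence in `A ≅ A` consists of maps equal to the identity and
to `f` whose composite is equal to the identity, so `f = id`. If `isEquiv id` is a proposition, its
elements with sections `f` and `id` are equal, hence so are the sections. If equivalences are stable
under post-composition, apply this to the constant-path map from `A` to its type of paths: `a ↦ (f
a, a, H a)` then factors through constant paths up to identity, and comparing sources with targets
gives `f = id`.

Out of the hub. Applied to `f ∘ s` and `r ∘ f`, it makes an equivalence categorical, and identities
of maps, unlike homotopies, can be whiskered, which gives post-composition. For weak function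
extensionality, the endomap of `Σ a, P a` that sends each fibre to its center is homotopic to the
identity, hence equal to it; pulling this equality back along sections contracts `Π a, P a`, after a
correction by a loop at `id`. Function extensionality follows from the contractibility of a product
of singletons. Since `Φ` acts by `happly` on two components, it is then an equivalence. Finally, the
sections and retractions of an invertible map are fibres of post- and precomposition over the
identity, so `isEquiv f` is a product of contractible types as soon as it is inhabited.

All this takes place inside the object theory. Proof terms are written in an annotated syntax and
checked by a normalizer, which is proved sound for `Der` (`norm_sound`) and run by the kernel.
Neither its completeness nor its termination is needed. Soundness rests on
`Der.stableUnder_substOk`, `Der.functional` and `Der.inverted`. -/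

namespace ITT

/-! ### Annotated syntax for the proof terms -/

/-- Church-style expressions over a base context: `base i` are opaque types, `fam a` is an opaque
family over `base 0`, and `con i` are opaque terms. A pair carries its `Σ`-type and the type of its
second component. -/
inductive Exp : Type
  | var (n : ℕ)
  | pi (A B : Exp)
  | lam (A b : Exp)
  | app (f a : Exp)
  | sigma (A B : Exp)
  | pair (S D a b : Exp)
  | fst (p : Exp)
  | snd (p : Exp)
  | idt (A a b : Exp)
  | refl (a : Exp)
  | elimId (C d p : Exp)
  | base (i : ℕ)
  | fam (a : Exp)
  | con (i : ℕ)

namespace Exp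

/-- Syntactic equality, as a Boolean function. -/
def beq : Exp → Exp → Bool
  | var m, var n => Nat.beq m n
  | pi A B, pi A' B' => beq A A' && beq B B'
  | lam A b, lam A' b' => beq A A' && beq b b'
  | app f a, app f' a' => beq f f' && beq a a'
  | sigma A B, sigma A' B' => beq A A' && beq B B'
  | pair S D a b, pair S' D' a' b' => beq S S' && beq D D' && beq a a' && beq b b'
  | fst p, fst p' => beq p p'
  | snd p, snd p' => beq p p'
  | idt A a b, idt A' a' b' => beq A A' && beq a a' && beq b b'
  | refl a, refl a' => beq a a'
  | elimId C d p, elimId C' d' p' => beq C C' && beq d d' && beq p p'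
  | base i, base j => Nat.beq i j
  | fam a, fam a' => beq a a'
  | con i, con j => Nat.beq i j
  | _, _ => false

theorem eq_of_beq : ∀ {s t : Exp}, beq s t = true → s = t := by
  intro s
  induction s <;> intro t h <;> cases t <;>
    simp_all [beq] <;> grind

/-- Renaming of variables. -/
def rename : Exp → (ℕ → ℕ) → Exp
  | var n, ρ => var (ρ n)
  | pi A B, ρ => pi (A.rename ρ) (B.rename (liftRen ρ))
  | lam A b, ρ => lam (A.rename ρ) (b.rename (liftRen ρ))
  | app f a, ρ => app (f.rename ρ) (a.rename ρ)
  | sigma A B, ρ => sigma (A.rename ρ) (B.rename (liftRen ρ))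
  | pair S D a b, ρ => pair (S.rename ρ) (D.rename ρ) (a.rename ρ) (b.rename ρ)
  | fst p, ρ => fst (p.rename ρ)
  | snd p, ρ => snd (p.rename ρ)
  | idt A a b, ρ => idt (A.rename ρ) (a.rename ρ) (b.rename ρ)
  | refl a, ρ => refl (a.rename ρ)
  | elimId C d p, ρ => elimId (C.rename (liftRen (liftRen ρ))) (d.rename ρ) (p.rename ρ)
  | base i, _ => base i
  | fam a, ρ => fam (a.rename ρ)
  | con i, _ => con i

/-- Weakening by one variable. -/
def wk (t : Exp) : Exp := t.rename (· + 1)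

/-- Lift a substitution under one binder. -/
def lift (σ : ℕ → Exp) : ℕ → Exp
  | 0 => var 0
  | n + 1 => (σ n).wk

/-- Extend a substitution by a value for the innermost variable. -/
def cons (a : Exp) (σ : ℕ → Exp) : ℕ → Exp
  | 0 => a
  | n + 1 => σ n

/-- Simultaneous substitution. -/
def subst : Exp → (ℕ → Exp) → Exp
  | var n, σ => σ n
  | pi A B, σ => pi (A.subst σ) (B.subst (lift σ))
  | lam A b, σ => lam (A.subst σ) (b.subst (lift σ))
  | app f a, σ => app (f.subst σ) (a.subst σ)
  | sigma A B, σ => sigma (A.subst σ) (B.subst (lift σ))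
  | pair S D a b, σ => pair (S.subst σ) (D.subst σ) (a.subst σ) (b.subst σ)
  | fst p, σ => fst (p.subst σ)
  | snd p, σ => snd (p.subst σ)
  | idt A a b, σ => idt (A.subst σ) (a.subst σ) (b.subst σ)
  | refl a, σ => refl (a.subst σ)
  | elimId C d p, σ => elimId (C.subst (lift (lift σ))) (d.subst σ) (p.subst σ)
  | base i, _ => base i
  | fam a, σ => fam (a.subst σ)
  | con i, _ => con i

/-- Replace the innermost variable. -/
def inst (B a : Exp) : Exp := B.subst (cons a var)

/-- Replace variable `1` by `b` and variable `0` by `p`. -/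
def inst₂ (C b p : Exp) : Exp := C.subst (cons p (cons b var))

/-- Whether an expression is neither a function nor a pair. -/
def isElim : Exp → Bool
  | lam _ _ => false
  | pair _ _ _ _ => false
  | _ => true

/-- Whether an expression is not a reflexivity path. -/
def notRefl : Exp → Bool
  | .refl _ => false
  | _ => true

/-- Whether an expression does not have the form of an application to the innermost variable. -/
def notEta : Exp → Bool
  | app _ (var 0) => false
  | _ => true

/-- A test that succeeds only for expressions without `β`-redex and `η`-redex. -/
def noRedex : Exp → Bool
  | pi A B => noRedex A && noRedex B
  | lam A b => notEta b && noRedex A && noRedex b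
  | app f a => isElim f && noRedex f && noRedex a
  | sigma A B => noRedex A && noRedex B
  | pair _ _ (fst _) (snd _) => false
  | pair S D a b => noRedex S && noRedex D && noRedex a && noRedex b
  | fst p => isElim p && noRedex p
  | snd p => isElim p && noRedex p
  | idt A a b => noRedex A && noRedex a && noRedex b
  | .refl a => noRedex a
  | elimId C d p => notRefl p && noRedex C && noRedex d && noRedex p
  | fam a => noRedex a
  | _ => true

end Exp

/-! ### A normalizing type checker -/

open Exp

/-- The type of a variable. -/
def lookup : List Exp → ℕ → Option Exp
  | [], _ => none
  | A :: _, 0 => some A.wk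
  | _ :: Δ, n + 1 => (lookup Δ n).map wk

/-- Return `x` if the test succeeds. -/
def check {α : Type} (c : Bool) (x : α) : Option α := cond c (some x) none

section step

variable (K : ℕ → Option Exp) (nf : List Exp → Exp → Option (Exp × Exp))
  (nfT : List Exp → Exp → Option Exp)

/-- The normal form of a type that may be normal already. -/
def quickTy (Δ : List Exp) (T : Exp) : Option Exp := cond (noRedex T) (some T) (nfT Δ T)

/-- One step of the normalization of types. -/
def stepTy (Δ : List Exp) : Exp → Option Exp
  | pi A B => (nfT Δ A).bind fun A' => (nfT (A' :: Δ) B).bind fun B' => some (pi A' B')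
  | sigma A B => (nfT Δ A).bind fun A' => (nfT (A' :: Δ) B).bind fun B' => some (sigma A' B')
  | idt A a b => (nfT Δ A).bind fun A' => (nf Δ a).bind fun r => (nf Δ b).bind fun s =>
      check (beq r.2 A' && beq s.2 A') (idt A' r.1 s.1)
  | base i => some (base i)
  | fam a => (nf Δ a).bind fun r => check (beq r.2 (base 0)) (fam r.1)
  | _ => none

/-- The normal form of a function with normal body `b`. -/
def etaLam (Δ : List Exp) (A B : Exp) : Exp → Option (Exp × Exp)
  | app f (var 0) =>
      -- Instantiating with `var 0` is a tentative strengthening of `f`. The test that weakening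
      -- restores `f` certifies that the bound variable did not occur in it.
      (nf Δ (f.inst (var 0))).bind fun r =>
        cond (beq r.1.wk f && beq r.2 (pi A B)) (some r) (some (lam A (app f (var 0)), pi A B))
  | b => some (lam A b, pi A B)

/-- The normal form of a pair with normal components `a` and `b`. -/
def etaPair (Δ : List Exp) (A B D : Exp) : Exp → Exp → Option (Exp × Exp)
  | fst p, snd q =>
      (nf Δ p).bind fun r =>
        cond (beq r.1 p && beq p q && beq r.2 (sigma A B)) (some r)
          (some (pair (sigma A B) D (fst p) (snd q), sigma A B))
  | a, b => some (pair (sigma A B) D a b, sigma A B)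

/-- The normal form of a normal function applied to a normal argument, of type `R`. -/
def appNf (Δ : List Exp) (R a : Exp) : Exp → Option (Exp × Exp)
  -- Renormalization is skipped only for eliminations: for a function or a pair, the typing data
  -- recorded by `Good` would have to be carried through the substitution.
  | lam _ b => cond (isElim (b.inst a) && noRedex (b.inst a)) (some (b.inst a, R))
      ((nf Δ (b.inst a)).bind fun r => check (beq r.2 R) r)
  | f => some (app f a, R)

/-- The normal form of the first projection of a normal form. -/
def fstNf : Exp → Exp
  | pair _ _ a _ => a
  | p => fst p

/-- The normal form of the second projection of a normal form, with its type. -/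
def sndNf (Δ : List Exp) (B : Exp) : Exp → Option (Exp × Exp)
  | pair _ D _ b => some (b, D)
  | p => (quickTy nfT Δ (B.inst (fst p))).bind fun D => some (snd p, D)

/-- The normal form of a path induction with normal ingredients, where `b` is the endpoint of
the path and `D` is the type of `d`. -/
def elimNf (Δ : List Exp) (a b C d D : Exp) : Exp → Option (Exp × Exp)
  | .refl c => check (beq c a && beq b a) (d, D)
  | p => (quickTy nfT Δ (C.inst₂ b p)).bind fun R => some (elimId C d p, R)

/-- One step of the normalization of terms; the result is a normal form and its type. -/
def stepTm (Δ : List Exp) : Exp → Option (Exp × Exp)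
  | var n => (lookup Δ n).bind fun T => some (var n, T)
  | con i => (K i).bind fun T => some (con i, T.rename (· + Δ.length))
  | lam A b => (nfT Δ A).bind fun A' => (nf (A' :: Δ) b).bind fun r => etaLam nf Δ A' r.2 r.1
  | app f a => (nf Δ f).bind fun r => (nf Δ a).bind fun s =>
      match r.2 with
      | pi A B => cond (beq s.2 A)
          ((quickTy nfT Δ (B.inst s.1)).bind fun R => appNf nf Δ R s.1 r.1) none
      | _ => none
  | pair S _ a b => (nfT Δ S).bind fun S' => (nf Δ a).bind fun r => (nf Δ b).bind fun s =>
      match S' with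
      | sigma A B => (quickTy nfT Δ (B.inst r.1)).bind fun D =>
          cond (beq r.2 A && beq s.2 D) (etaPair nf Δ A B D r.1 s.1) none
      | _ => none
  | fst p => (nf Δ p).bind fun r =>
      match r.2 with
      | sigma A _ => some (fstNf r.1, A)
      | _ => none
  | snd p => (nf Δ p).bind fun r =>
      match r.2 with
      | sigma _ B => sndNf nfT Δ B r.1
      | _ => none
  | .refl a => (nf Δ a).bind fun r => some (refl r.1, idt r.2 r.1 r.1)
  | elimId C d p => (nf Δ p).bind fun r =>
      match r.2 with
      | idt A a b => (nfT (idt A.wk a.wk (var 0) :: A :: Δ) C).bind fun C' =>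
          (quickTy nfT Δ (C'.inst₂ a (refl a))).bind fun D => (nf Δ d).bind fun s =>
            cond (beq s.2 D) (elimNf nfT Δ a b C' s.1 D r.1) none
      | _ => none
  | _ => none

end step

/-- Normalization with bounded recursion depth. -/
def norm (K : ℕ → Option Exp) : ℕ →
    (List Exp → Exp → Option (Exp × Exp)) × (List Exp → Exp → Option Exp)
  | 0 => (fun _ _ => none, fun _ _ => none)
  | n + 1 => (stepTm K (norm K n).1 (norm K n).2, stepTy (norm K n).1 (norm K n).2)

/-- The closed expression `t` has the closed type `T`. -/
def hasType (K : ℕ → Option Exp) (t T : Exp) : Bool :=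
  -- The number 1000 only bounds the recursion depth; a bound that is too small makes the check fail
  -- and never makes it unsound.
  match (norm K 1000).1 [] t, (norm K 1000).2 [] T with
  | some r, some S => beq r.2 S
  | _, _ => false

/-- In the context `Δ`, the type `T` is well-formed and normal. -/
def isTy (K : ℕ → Option Exp) (Δ : List Exp) (T : Exp) : Bool :=
  match (norm K 1000).2 Δ T with
  | some T' => beq T' T
  | none => false

/-- In the context `Δ`, the term `t` is normal and has the normal type `T`. -/
def isTm (K : ℕ → Option Exp) (Δ : List Exp) (t T : Exp) : Bool :=
  match (norm K 1000).1 Δ t with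
  | some r => beq r.1 t && beq r.2 T
  | none => false

end ITT

namespace ITT

open Raw Judgment

/-! ## Calculus of substitutions -/

theorem liftRen_comp (ρ ρ' : ℕ → ℕ) : liftRen ρ' ∘ liftRen ρ = liftRen (ρ' ∘ ρ) := by
  funext n; cases n <;> rfl

theorem liftSub_comp_liftRen (σ : ℕ → Raw) (ρ : ℕ → ℕ) :
    liftSub σ ∘ liftRen ρ = liftSub (σ ∘ ρ) := by
  funext n; cases n <;> rfl

theorem liftSub_var_comp (ρ : ℕ → ℕ) : liftSub (var ∘ ρ) = var ∘ liftRen ρ := by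
  funext n; cases n <;> rfl

theorem liftSub_var : liftSub var = var := by
  funext n; cases n <;> rfl

namespace Raw

theorem rename_rename (t : Raw) : ∀ ρ ρ' : ℕ → ℕ, (t.rename ρ).rename ρ' = t.rename (ρ' ∘ ρ) := by
  induction t <;> intro ρ ρ' <;> simp only [rename, liftRen_comp, Function.comp_apply, *]

theorem rename_subst (t : Raw) : ∀ (ρ : ℕ → ℕ) (σ : ℕ → Raw),
    (t.rename ρ).subst σ = t.subst (σ ∘ ρ) := by
  induction t <;> intro ρ ρ' <;>
    simp only [rename, subst, liftSub_comp_liftRen, Function.comp_apply, *]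

theorem rename_eq_subst (t : Raw) : ∀ ρ : ℕ → ℕ, t.rename ρ = t.subst (var ∘ ρ) := by
  induction t <;> intro ρ <;>
    simp only [rename, subst, liftSub_var_comp, Function.comp_apply, *]

theorem subst_var (t : Raw) : t.subst var = t := by
  induction t <;> simp only [subst, liftSub_var, *]

end Raw

theorem rename_comp_liftSub (σ : ℕ → Raw) (ρ : ℕ → ℕ) :
    (fun n => (liftSub σ n).rename (liftRen ρ)) = liftSub fun n => (σ n).rename ρ := by
  funext n
  cases n with
  | zero => rfl
  | succ n => simp only [liftSub, wk, rename_rename]; rfl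

namespace Raw

theorem subst_rename (t : Raw) : ∀ (σ : ℕ → Raw) (ρ : ℕ → ℕ),
    (t.subst σ).rename ρ = t.subst fun n => (σ n).rename ρ := by
  induction t <;> intro σ ρ <;> simp only [rename, subst, rename_comp_liftSub, *]

end Raw

theorem subst_comp_liftSub (σ τ : ℕ → Raw) :
    (fun n => (liftSub σ n).subst (liftSub τ)) = liftSub fun n => (σ n).subst τ := by
  funext n
  cases n with
  | zero => rfl
  | succ n => simp only [liftSub, wk, rename_subst, subst_rename]; rfl

namespace Raw

theorem subst_subst (t : Raw) : ∀ σ τ : ℕ → Raw,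
    (t.subst σ).subst τ = t.subst fun n => (σ n).subst τ := by
  induction t <;> intro σ τ <;> simp only [subst, subst_comp_liftSub, *]

theorem wk_subst_liftSub (t : Raw) (σ : ℕ → Raw) : t.wk.subst (liftSub σ) = (t.subst σ).wk := by
  simp only [wk, rename_subst, subst_rename]; rfl

theorem wk_subst_consSub (t a : Raw) (σ : ℕ → Raw) : t.wk.subst (consSub a σ) = t.subst σ := by
  simp only [wk, rename_subst]; rfl

theorem wk_inst (t a : Raw) : t.wk.inst a = t := by
  rw [inst, wk_subst_consSub, subst_var]

theorem inst_subst (B a : Raw) (σ : ℕ → Raw) :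
    (B.inst a).subst σ = (B.subst (liftSub σ)).inst (a.subst σ) := by
  simp only [inst, subst_subst]
  congr 1
  funext n
  cases n with
  | zero => rfl
  | succ n => exact (wk_inst _ _).symm

theorem inst₂_subst (C b p : Raw) (σ : ℕ → Raw) :
    (C.inst₂ b p).subst σ = (C.subst (liftSub (liftSub σ))).inst₂ (b.subst σ) (p.subst σ) := by
  simp only [inst₂, subst_subst]
  congr 1
  funext n
  rcases n with _ | _ | n
  · rfl
  · rfl
  · simp only [liftSub, wk_subst_consSub, consSub, subst_var]; rfl

theorem substInl_subst (C : Raw) (σ : ℕ → Raw) :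
    C.substInl.subst (liftSub σ) = (C.subst (liftSub σ)).substInl := by
  simp only [substInl, subst_subst]
  congr 1
  funext n
  cases n with
  | zero => rfl
  | succ n =>
    simp only [liftSub, wk_subst_consSub, consSub]
    exact rename_eq_subst _ _

theorem substInr_subst (C : Raw) (σ : ℕ → Raw) :
    C.substInr.subst (liftSub σ) = (C.subst (liftSub σ)).substInr := by
  simp only [substInr, subst_subst]
  congr 1
  funext n
  cases n with
  | zero => rfl
  | succ n =>
    simp only [liftSub, wk_subst_consSub, consSub]
    exact rename_eq_subst _ _

end Raw

/-! ## Admissibility of substitution -/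

/-- The judgment `J` remains derivable under all substitutions in the class `M`. -/
def StableUnder (X : Scheme) (M : Ctx → (ℕ → Raw) → Ctx → Prop) : Judgment → Prop
  | ctx _ => True
  | ty Γ A => ∀ {Δ σ}, M Δ σ Γ → Der X (ty Δ (A.subst σ))
  | tyEq Γ A B => ∀ {Δ σ}, M Δ σ Γ → Der X (tyEq Δ (A.subst σ) (B.subst σ))
  | tm Γ a A => ∀ {Δ σ}, M Δ σ Γ → Der X (tm Δ (a.subst σ) (A.subst σ))
  | tmEq Γ a b A => ∀ {Δ σ}, M Δ σ Γ → Der X (tmEq Δ (a.subst σ) (b.subst σ) (A.subst σ))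

/-- One induction over derivations serves both renamings and substitutions. Renamings have to come
first, because lifting a typed substitution under a binder uses weakening. -/
theorem Der.stableUnder {X : Scheme} {M : Ctx → (ℕ → Raw) → Ctx → Prop}
    (hc : ∀ {Δ σ Γ}, M Δ σ Γ → Der X (ctx Δ))
    (hv : ∀ {Δ σ Γ n A}, M Δ σ Γ → Lookup Γ n A → Der X (tm Δ (σ n) (A.subst σ)))
    (ext : ∀ {Δ σ Γ A}, M Δ σ Γ → Der X (ty Δ (A.subst σ)) →
      M (A.subst σ :: Δ) (liftSub σ) (A :: Γ))
    (wk : ∀ {Δ σ Γ B}, M Δ σ Γ → Der X (ty Δ B) → M (B :: Δ) (fun n => (σ n).wk) Γ)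
    {J : Judgment} (h : Der X J) : StableUnder X M J := by
  have motive {Δ σ Γ} {A a : Raw} {P : Ctx → (ℕ → Raw) → Prop} (m : M Δ σ Γ)
      (hA : ∀ {Δ σ}, M Δ σ Γ → Der X (ty Δ (A.subst σ)))
      (ha : ∀ {Δ σ}, M Δ σ Γ → Der X (tm Δ (a.subst σ) (A.subst σ)))
      (h : ∀ {Δ σ}, M Δ σ (Raw.idt A.wk a.wk (.var 0) :: A :: Γ) → P Δ σ) :
      P (Raw.idt (A.subst σ).wk (a.subst σ).wk (.var 0) :: A.subst σ :: Δ)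
        (liftSub (liftSub σ)) := by
    have m' := ext m (hA m)
    have hm := ext (A := Raw.idt A.wk a.wk (.var 0)) m' ?_
    · simp only [Raw.subst, wk_subst_liftSub] at hm
      exact h hm
    · have hA' := hA (wk m (hA m))
      have ha' := ha (wk m (hA m))
      simp only [Raw.wk, ← subst_rename] at hA' ha'
      simp only [Raw.subst, wk_subst_liftSub]
      exact .id_form hA' ha' (.var (hc m') (.zero _ _))
  induction h <;> try (intro Δ σ m)
  case ctx_nil => trivial
  case ctx_cons => trivial
  case var h _ => exact hv m h
  case conv a b => exact .conv (a m) (b m)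
  case conv_eq a b => exact .conv_eq (a m) (b m)
  case ty_refl a => exact .ty_refl (a m)
  case ty_symm a => exact .ty_symm (a m)
  case ty_trans a b => exact .ty_trans (a m) (b m)
  case tm_refl a => exact .tm_refl (a m)
  case tm_symm a => exact .tm_symm (a m)
  case tm_trans a b => exact .tm_trans (a m) (b m)
  case pi_form a b => exact .pi_form (a m) (b (ext m (a m)))
  case pi_form_eq a b c => exact .pi_form_eq (a m) (b m) (c (ext m (a m)))
  case lam a b => exact .lam (a m) (b (ext m (a m)))
  case lam_eq a b => exact .lam_eq (a m) (b (ext m (a m)))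
  case app a b =>
    rw [inst_subst]
    exact .app (a m) (b m)
  case app_eq a b =>
    rw [inst_subst]
    exact .app_eq (a m) (b m)
  case pi_beta a b c =>
    simp only [inst_subst]
    exact .pi_beta (a m) (b (ext m (a m))) (c m)
  case pi_eta a =>
    simp only [Raw.subst, wk_subst_liftSub]
    exact .pi_eta (a m)
  case sigma_form a b => exact .sigma_form (a m) (b (ext m (a m)))
  case sigma_form_eq a b c => exact .sigma_form_eq (a m) (b m) (c (ext m (a m)))
  case pair a b c d =>
    exact .pair (a m) (b (ext m (a m))) (c m) (by simpa only [inst_subst] using d m)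
  case pair_eq a b c d =>
    exact .pair_eq (a m) (b (ext m (a m))) (c m) (by simpa only [inst_subst] using d m)
  case fst a => exact .fst (a m)
  case fst_eq a => exact .fst_eq (a m)
  case snd a =>
    rw [inst_subst]
    exact .snd (a m)
  case snd_eq a =>
    rw [inst_subst]
    exact .snd_eq (a m)
  case fst_beta a b c d =>
    exact .fst_beta (a m) (b (ext m (a m))) (c m) (by simpa only [inst_subst] using d m)
  case snd_beta a b c d =>
    rw [inst_subst]
    exact .snd_beta (a m) (b (ext m (a m))) (c m) (by simpa only [inst_subst] using d m)
  case sigma_eta a => exact .sigma_eta (a m)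
  case id_form a b c => exact .id_form (a m) (b m) (c m)
  case id_form_eq a b c => exact .id_form_eq (a m) (b m) (c m)
  case refl a => exact .refl (a m)
  case refl_eq a => exact .refl_eq (a m)
  case elimId a b c d e f =>
    rw [inst₂_subst]
    exact .elimId (a m) (b m) (motive m a b c) (by simpa only [inst₂_subst, Raw.subst] using d m)
      (e m) (f m)
  case elimId_eq a b c d e f =>
    rw [inst₂_subst]
    exact .elimId_eq (a m) (b m) (motive m a b c)
      (by simpa only [inst₂_subst, Raw.subst] using d m) (e m) (f m)
  case id_beta a b c d =>
    rw [inst₂_subst]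
    exact .id_beta (a m) (b m) (motive m a b c) (by simpa only [inst₂_subst, Raw.subst] using d m)
  case sum_form a b => exact .sum_form (a m) (b m)
  case sum_form_eq a b => exact .sum_form_eq (a m) (b m)
  case inl a b => exact .inl (a m) (b m)
  case inl_eq a b => exact .inl_eq (a m) (b m)
  case inr a b => exact .inr (a m) (b m)
  case inr_eq a b => exact .inr_eq (a m) (b m)
  case elimSum a b c l r s =>
    rw [inst_subst]
    exact .elimSum (a m) (b m) (c (ext (A := .sum _ _) m (.sum_form (a m) (b m))))
      (by simpa only [substInl_subst] using l (ext m (a m)))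
      (by simpa only [substInr_subst] using r (ext m (b m))) (s m)
  case elimSum_eq a b c l r s =>
    rw [inst_subst]
    exact .elimSum_eq (a m) (b m) (c (ext (A := .sum _ _) m (.sum_form (a m) (b m))))
      (by simpa only [substInl_subst] using l (ext m (a m)))
      (by simpa only [substInr_subst] using r (ext m (b m))) (s m)
  case inl_beta a b c l r s =>
    simp only [inst_subst]
    exact .inl_beta (a m) (b m) (c (ext (A := .sum _ _) m (.sum_form (a m) (b m))))
      (by simpa only [substInl_subst] using l (ext m (a m)))
      (by simpa only [substInr_subst] using r (ext m (b m))) (s m)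
  case inr_beta a b c l r s =>
    simp only [inst_subst]
    exact .inr_beta (a m) (b m) (c (ext (A := .sum _ _) m (.sum_form (a m) (b m))))
      (by simpa only [substInl_subst] using l (ext m (a m)))
      (by simpa only [substInr_subst] using r (ext m (b m))) (s m)
  case empty_form => exact .empty_form (hc m)
  case elimEmpty c s =>
    rw [inst_subst]
    exact .elimEmpty (c (ext (A := .empty) m (.empty_form (hc m)))) (s m)
  case elimEmpty_eq c s =>
    rw [inst_subst]
    exact .elimEmpty_eq (c (ext (A := .empty) m (.empty_form (hc m)))) (s m)
  case unit_form => exact .unit_form (hc m)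
  case star => exact .star (hc m)
  case unit_eta a => exact .unit_eta (a m)
  case univ_form => exact .univ_form (hc m)
  case el a => exact .el (a m)
  case el_eq a => exact .el_eq (a m)
  case univ_pi a b => exact .univ_pi (a m) (b (ext m (.el (a m))))
  case univ_pi_eq a b c => exact .univ_pi_eq (a m) (b m) (c (ext m (.el (a m))))
  case univ_sigma a b => exact .univ_sigma (a m) (b (ext m (.el (a m))))
  case univ_sigma_eq a b c => exact .univ_sigma_eq (a m) (b m) (c (ext m (.el (a m))))
  case univ_id a b c => exact .univ_id (a m) (b m) (c m)
  case univ_id_eq a b c => exact .univ_id_eq (a m) (b m) (c m)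
  case univ_sum a b => exact .univ_sum (a m) (b m)
  case univ_sum_eq a b => exact .univ_sum_eq (a m) (b m)
  case univ_empty => exact .univ_empty (hc m)
  case univ_unit => exact .univ_unit (hc m)
  case post hX _ a => exact .post (X.mem_subst _ _ hX) (a m)
  case post_eq hX hX' _ a => exact .post_eq (X.mem_subst _ _ hX) (X.mem_subst _ _ hX') (a m)

/-- Renamings that preserve the types of variables. -/
def RenameOk (X : Scheme) (Δ : Ctx) (σ : ℕ → Raw) (Γ : Ctx) : Prop :=
  Der X (ctx Δ) ∧ ∃ ρ : ℕ → ℕ, σ = Raw.var ∘ ρ ∧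
    ∀ n A, Lookup Γ n A → Lookup Δ (ρ n) (A.rename ρ)

theorem Der.stableUnder_renameOk {X : Scheme} {J : Judgment} (h : Der X J) :
    StableUnder X (RenameOk X) J := by
  refine h.stableUnder (M := RenameOk X) And.left ?_ ?_ ?_
  · rintro Δ _ Γ n A ⟨hΔ, ρ, rfl, hρ⟩ hn
    rw [← rename_eq_subst]
    exact .var hΔ (hρ _ _ hn)
  · rintro Δ _ Γ A ⟨hΔ, ρ, rfl, hρ⟩ hA
    refine ⟨.ctx_cons hΔ hA, liftRen ρ, liftSub_var_comp ρ, ?_⟩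
    rw [← rename_eq_subst]
    intro n B hn
    cases hn with
    | zero =>
      have := Lookup.zero Δ (A.rename ρ)
      rw [Raw.wk, rename_rename] at this ⊢
      exact this
    | succ _ n B _ hn =>
      have := Lookup.succ _ _ _ (A.rename ρ) (hρ _ _ hn)
      rw [Raw.wk, rename_rename] at this ⊢
      exact this
  · rintro Δ _ Γ B ⟨hΔ, ρ, rfl, hρ⟩ hB
    refine ⟨.ctx_cons hΔ hB, (· + 1) ∘ ρ, rfl, fun n A hn => ?_⟩
    rw [← rename_rename]
    exact .succ _ _ _ _ (hρ _ _ hn)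

theorem renameOk_wk {X : Scheme} {Γ : Ctx} {B : Raw} (hB : Der X (ctx (B :: Γ))) :
    RenameOk X (B :: Γ) (Raw.var ∘ (· + 1)) Γ :=
  ⟨hB, _, rfl, fun _ _ hn => .succ _ _ _ _ hn⟩

theorem Der.wk_ty {X : Scheme} {Γ : Ctx} {A B : Raw} (h : Der X (ty Γ A))
    (hB : Der X (ctx (B :: Γ))) : Der X (ty (B :: Γ) A.wk) := by
  rw [Raw.wk, rename_eq_subst]
  exact h.stableUnder_renameOk (renameOk_wk hB)

theorem Der.wk_tm {X : Scheme} {Γ : Ctx} {a A B : Raw} (h : Der X (tm Γ a A))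
    (hB : Der X (ctx (B :: Γ))) : Der X (tm (B :: Γ) a.wk A.wk) := by
  rw [Raw.wk, Raw.wk, rename_eq_subst, rename_eq_subst]
  exact h.stableUnder_renameOk (renameOk_wk hB)

/-- Well-typed substitutions. -/
def SubstOk (X : Scheme) (Δ : Ctx) (σ : ℕ → Raw) (Γ : Ctx) : Prop :=
  Der X (ctx Δ) ∧ ∀ n A, Lookup Γ n A → Der X (tm Δ (σ n) (A.subst σ))

theorem SubstOk.wk {X : Scheme} {Γ Δ : Ctx} {σ : ℕ → Raw} {B : Raw} (hσ : SubstOk X Δ σ Γ)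
    (hB : Der X (ty Δ B)) : SubstOk X (B :: Δ) (fun n => (σ n).wk) Γ := by
  have hc := Der.ctx_cons hσ.1 hB
  refine ⟨hc, fun n A hn => ?_⟩
  have := (hσ.2 n A hn).wk_tm hc
  rwa [Raw.wk, Raw.wk, subst_rename] at this

/-- Judgmentally equal well-typed substitutions. -/
def SubstEq (X : Scheme) (σ τ : ℕ → Raw) (Δ Γ : Ctx) : Prop :=
  SubstOk X Δ σ Γ ∧ ∀ n A, Lookup Γ n A → Der X (tmEq Δ (σ n) (τ n) (A.subst σ))

theorem SubstOk.lift {X : Scheme} {Γ Δ : Ctx} {σ : ℕ → Raw} {A : Raw} (hσ : SubstOk X Δ σ Γ)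
    (hA : Der X (ty Δ (A.subst σ))) : SubstOk X (A.subst σ :: Δ) (liftSub σ) (A :: Γ) := by
  have hc := Der.ctx_cons hσ.1 hA
  refine ⟨hc, fun n B hn => ?_⟩
  cases hn with
  | zero =>
    rw [wk_subst_liftSub]
    exact .var hc (.zero _ _)
  | succ _ n B _ hn =>
    rw [wk_subst_liftSub]
    exact (hσ.2 _ _ hn).wk_tm hc

theorem Der.stableUnder_substOk {X : Scheme} {J : Judgment} (h : Der X J) :
    StableUnder X (SubstOk X) J :=
  h.stableUnder (M := SubstOk X) And.left (fun m hn => m.2 _ _ hn) SubstOk.lift SubstOk.wk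

theorem SubstEq.lift {X : Scheme} {Γ Δ : Ctx} {σ τ : ℕ → Raw} {A : Raw}
    (h : SubstEq X σ τ Δ Γ) (hA : Der X (ty Δ (A.subst σ))) :
    SubstEq X (liftSub σ) (liftSub τ) (A.subst σ :: Δ) (A :: Γ) := by
  have hc := Der.ctx_cons h.1.1 hA
  refine ⟨h.1.lift hA, fun n B hn => ?_⟩
  cases hn with
  | zero =>
    rw [wk_subst_liftSub]
    exact .tm_refl (.var hc (.zero _ _))
  | succ _ n B _ hn =>
    rw [wk_subst_liftSub]
    have := (h.2 _ _ hn).stableUnder_renameOk (renameOk_wk hc)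
    simp only [← rename_eq_subst] at this
    exact this

/-- Types and terms respect the judgmental equality of substitutions. -/
def Functional (X : Scheme) : Judgment → Prop
  | ty Γ A => ∀ {Δ σ τ}, SubstEq X σ τ Δ Γ → Der X (tyEq Δ (A.subst σ) (A.subst τ))
  | tm Γ a A => ∀ {Δ σ τ}, SubstEq X σ τ Δ Γ →
      Der X (tmEq Δ (a.subst σ) (a.subst τ) (A.subst σ))
  | _ => True

/-- The congruence rules ask for well-typedness of the left sides only, which is why `SubstEq`
requires nothing of `τ` by itself. -/
theorem Der.functional {X : Scheme} {J : Judgment} (h : Der X J) : Functional X J := by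
  induction h <;> try trivial
  all_goals intro Δ σ τ m
  all_goals have S := @Der.stableUnder_substOk X
  case var h _ => exact m.2 _ _ h
  case conv h a _ => exact .conv_eq (a m) (S h m.1)
  case pi_form hA _ a b => exact .pi_form_eq (S hA m.1) (a m) (b (m.lift (S hA m.1)))
  case lam hA _ _ b => exact .lam_eq (S hA m.1) (b (m.lift (S hA m.1)))
  case app a b =>
    rw [inst_subst]
    exact .app_eq (a m) (b m)
  case sigma_form hA _ a b => exact .sigma_form_eq (S hA m.1) (a m) (b (m.lift (S hA m.1)))
  case pair hA hB _ _ _ _ a b =>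
    exact .pair_eq (S hA m.1) (S hB (m.lift (S hA m.1)).1) (a m)
      (by simpa only [inst_subst] using b m)
  case fst a => exact .fst_eq (a m)
  case snd a =>
    rw [inst_subst]
    exact .snd_eq (a m)
  case id_form a b c => exact .id_form_eq (a m) (b m) (c m)
  case refl a => exact .refl_eq (a m)
  case elimId Γ A a b C d p hA ha hC _ hb _ _ _ iC id _ ip =>
    rw [inst₂_subst]
    have m' := m.lift (S hA m.1)
    have hI : Der X (ty (A.subst σ :: Δ) ((Raw.idt A.wk a.wk (.var 0)).subst (liftSub σ))) := by
      simp only [Raw.subst, wk_subst_liftSub]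
      exact .id_form ((S hA m.1).wk_ty m'.1.1) (Der.wk_tm (S ha m.1) m'.1.1)
        (.var m'.1.1 (.zero _ _))
    have mC := m'.lift hI
    simp only [Raw.subst, wk_subst_liftSub] at mC
    exact .elimId_eq (S hA m.1) (S ha m.1) (iC mC)
      (by simpa only [inst₂_subst, Raw.subst] using id m) (S hb m.1) (ip m)
  case sum_form a b => exact .sum_form_eq (a m) (b m)
  case inl hB a _ => exact .inl_eq (a m) (S hB m.1)
  case inr hA _ _ b => exact .inr_eq (S hA m.1) (b m)
  case elimSum hA hB _ _ _ _ _ _ c l r s =>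
    rw [inst_subst]
    exact .elimSum_eq (S hA m.1) (S hB m.1)
      (c (m.lift (A := .sum _ _) (.sum_form (S hA m.1) (S hB m.1))))
      (by simpa only [substInl_subst] using l (m.lift (S hA m.1)))
      (by simpa only [substInr_subst] using r (m.lift (S hB m.1))) (s m)
  case empty_form => exact .ty_refl (.empty_form m.1.1)
  case elimEmpty c s =>
    rw [inst_subst]
    exact .elimEmpty_eq (c (m.lift (A := .empty) (.empty_form m.1.1))) (s m)
  case unit_form => exact .ty_refl (.unit_form m.1.1)
  case star => exact .tm_refl (.star m.1.1)
  case univ_form => exact .ty_refl (.univ_form m.1.1)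
  case el a => exact .el_eq (a m)
  case univ_pi hA _ a b => exact .univ_pi_eq (S hA m.1) (a m) (b (m.lift (S hA m.1).el))
  case univ_sigma hA _ a b => exact .univ_sigma_eq (S hA m.1) (a m) (b (m.lift (S hA m.1).el))
  case univ_id a b c => exact .univ_id_eq (a m) (b m) (c m)
  case univ_sum a b => exact .univ_sum_eq (a m) (b m)
  case univ_empty => exact .tm_refl (.univ_empty m.1.1)
  case univ_unit => exact .tm_refl (.univ_unit m.1.1)
  case post hX _ a => exact .post_eq (X.mem_subst _ _ hX) (X.mem_subst _ _ hX) (a m)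

/-- The context of a judgment. -/
def Judgment.context : Judgment → Ctx
  | .ctx Γ => Γ
  | .ty Γ _ => Γ
  | .tyEq Γ _ _ => Γ
  | .tm Γ _ _ => Γ
  | .tmEq Γ _ _ _ => Γ

theorem Der.context {X : Scheme} {J : Judgment} (h : Der X J) : Der X (Judgment.ctx J.context) := by
  induction h
  case ctx_nil => exact .ctx_nil
  case ctx_cons a b _ _ => exact .ctx_cons a b
  all_goals assumption

section inst

variable {X : Scheme} {Γ : Ctx} {A B a b t : Raw}

theorem SubstOk.inst (ha : Der X (tm Γ a A)) : SubstOk X Γ (consSub a Raw.var) (A :: Γ) := by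
  refine ⟨ha.context, fun n C hn => ?_⟩
  cases hn <;> rw [wk_subst_consSub, subst_var]
  · exact ha
  · exact .var ha.context ‹_›

theorem Der.inst_ty (hB : Der X (ty (A :: Γ) B)) (ha : Der X (tm Γ a A)) :
    Der X (ty Γ (B.inst a)) :=
  hB.stableUnder_substOk (.inst ha)

theorem Der.inst_tm (ht : Der X (tm (A :: Γ) t B)) (ha : Der X (tm Γ a A)) :
    Der X (tm Γ (t.inst a) (B.inst a)) :=
  ht.stableUnder_substOk (.inst ha)

theorem Der.inst_congr (hB : Der X (ty (A :: Γ) B)) (ha : Der X (tm Γ a A))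
    (h : Der X (tmEq Γ a b A)) : Der X (tyEq Γ (B.inst a) (B.inst b)) := by
  refine hB.functional ⟨.inst ha, fun n C hn => ?_⟩
  cases hn <;> rw [wk_subst_consSub, subst_var]
  · exact h
  · exact .tm_refl (.var ha.context ‹_›)

theorem Der.inst₂_ty {C p : Raw} (hC : Der X (ty (Raw.idt A.wk a.wk (.var 0) :: A :: Γ) C))
    (hb : Der X (tm Γ b A)) (hp : Der X (tm Γ p (.idt A a b))) :
    Der X (ty Γ (C.inst₂ b p)) := by
  refine hC.stableUnder_substOk ⟨hb.context, fun n D hn => ?_⟩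
  cases hn <;> rw [wk_subst_consSub]
  · simp only [Raw.subst, wk_subst_consSub, subst_var]
    exact hp
  · exact (SubstOk.inst hb).2 _ _ ‹_›

end inst

/-! ## Inversion -/

/-- What the derivability of `J` says about the components of the type or term it is about. -/
def Inverted (X : Scheme) : Judgment → Prop
  | ctx (A :: Γ) => Der X (ctx Γ) ∧ Der X (ty Γ A)
  | ty Γ (.pi A B) => Der X (ty Γ A) ∧ Der X (ty (A :: Γ) B)
  | ty Γ (.sigma A B) => Der X (ty Γ A) ∧ Der X (ty (A :: Γ) B)
  | ty Γ (.idt A a b) => Der X (ty Γ A) ∧ Der X (tm Γ a A) ∧ Der X (tm Γ b A)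
  | tm Γ (.pi A B) _ => Der X (ty Γ A) ∧ Der X (ty (A :: Γ) B)
  | tm Γ (.sigma A B) _ => Der X (ty Γ A) ∧ Der X (ty (A :: Γ) B)
  | tm Γ (.idt A a b) _ => Der X (ty Γ A) ∧ Der X (tm Γ a A) ∧ Der X (tm Γ b A)
  | _ => True

/-- With a universe à la Russell, a type may come from `el`, so type formers must be inverted as
terms too; the clauses ignore the type of the term and so survive `conv`. Inverting `lam` or `pair`
would require injectivity of `pi` and `sigma`, and is avoided. -/
theorem Der.inverted {X : Scheme} {J : Judgment} (h : Der X J) : Inverted X J := by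
  induction h
  case ctx_cons a b _ _ => exact ⟨a, b⟩
  case conv Γ a A B _ _ ih _ => cases a <;> exact ih
  case pi_form a b _ _ => exact ⟨a, b⟩
  case sigma_form a b _ _ => exact ⟨a, b⟩
  case id_form a b c _ _ _ => exact ⟨a, b, c⟩
  case el Γ A _ ih => cases A <;> exact ih
  case univ_pi a b _ _ => exact ⟨a.el, b.el⟩
  case univ_sigma a b _ _ => exact ⟨a.el, b.el⟩
  case univ_id a b c _ _ _ => exact ⟨a.el, b, c⟩
  all_goals trivial

end ITT

namespace ITT

open Raw Judgment

/-! ## Interpretation of expressions -/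

/-- Raw expressions interpreting the opaque types, the opaque family and the opaque terms. -/
structure Model where
  base : ℕ → Raw
  fam : Raw
  con : ℕ → Raw

/-- The raw expression denoted by an expression in a context with `n` variables. -/
def Exp.raw (M : Model) : Exp → ℕ → Raw
  | .var k, _ => .var k
  | .pi A B, n => .pi (A.raw M n) (B.raw M (n + 1))
  | .lam _ b, n => .lam (b.raw M (n + 1))
  | .app f a, n => .app (f.raw M n) (a.raw M n)
  | .sigma A B, n => .sigma (A.raw M n) (B.raw M (n + 1))
  | .pair _ _ a b, n => .pair (a.raw M n) (b.raw M n)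
  | .fst p, n => .fst (p.raw M n)
  | .snd p, n => .snd (p.raw M n)
  | .idt A a b, n => .idt (A.raw M n) (a.raw M n) (b.raw M n)
  | .refl a, n => .refl (a.raw M n)
  | .elimId C d p, n => .elimId (C.raw M (n + 2)) (d.raw M n) (p.raw M n)
  | .base i, n => (M.base i).rename (· + n)
  | .fam a, n => M.fam.subst (consSub (a.raw M n) fun k => .var (k + n))
  | .con i, n => (M.con i).rename (· + n)

section raw

variable (M : Model)

/-- Opaque symbols denote expressions over the base context, so the renaming must fix the base
variables; they sit above the `n` local ones before it and above `m` after it. -/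
theorem raw_rename (t : Exp) : ∀ (n m : ℕ) (ρ : ℕ → ℕ), (∀ k, ρ (k + n) = k + m) →
    (t.rename ρ).raw M m = (t.raw M n).rename ρ := by
  have lift : ∀ {n m : ℕ} {ρ : ℕ → ℕ}, (∀ k, ρ (k + n) = k + m) →
      ∀ k, liftRen ρ (k + (n + 1)) = k + (m + 1) := fun h k => congrArg (· + 1) (h k)
  induction t <;> intro n m ρ h <;> simp only [Exp.rename, Exp.raw, Raw.rename]
  case pi a b => rw [a _ _ _ h, b _ _ _ (lift h)]
  case lam a b => rw [b _ _ _ (lift h)]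
  case app a b => rw [a _ _ _ h, b _ _ _ h]
  case sigma a b => rw [a _ _ _ h, b _ _ _ (lift h)]
  case pair a b => rw [a _ _ _ h, b _ _ _ h]
  case fst a => rw [a _ _ _ h]
  case snd a => rw [a _ _ _ h]
  case idt a b c => rw [a _ _ _ h, b _ _ _ h, c _ _ _ h]
  case refl a => rw [a _ _ _ h]
  case elimId a b c => rw [a _ _ _ (lift (lift h)), b _ _ _ h, c _ _ _ h]
  case base i =>
    rw [rename_rename]
    congr 1
    funext k
    exact (h k).symm
  case fam a =>
    rw [subst_rename, a _ _ _ h]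
    congr 1
    funext k
    cases k with
    | zero => rfl
    | succ k => exact congrArg Raw.var (h k).symm
  case con i =>
    rw [rename_rename]
    congr 1
    funext k
    exact (h k).symm

@[simp]
theorem raw_wk (t : Exp) (n : ℕ) : t.wk.raw M (n + 1) = (t.raw M n).wk :=
  raw_rename M t n (n + 1) _ fun _ => rfl

theorem raw_subst (t : Exp) : ∀ (n m : ℕ) (σ : ℕ → Exp) (τ : ℕ → Raw),
    (∀ k, (σ k).raw M m = τ k) → (∀ k, τ (k + n) = .var (k + m)) →
    (t.subst σ).raw M m = (t.raw M n).subst τ := by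
  have l₁ : ∀ {m : ℕ} {σ : ℕ → Exp} {τ : ℕ → Raw}, (∀ k, (σ k).raw M m = τ k) →
      ∀ k, (Exp.lift σ k).raw M (m + 1) = liftSub τ k := by
    intro m σ τ h k
    cases k with
    | zero => rfl
    | succ k => exact (raw_wk M _ _).trans (congrArg Raw.wk (h k))
  have l₂ : ∀ {n m : ℕ} {τ : ℕ → Raw}, (∀ k, τ (k + n) = .var (k + m)) →
      ∀ k, liftSub τ (k + (n + 1)) = .var (k + (m + 1)) :=
    fun h k => congrArg Raw.wk (h k)
  induction t <;> intro n m σ τ h h' <;> simp only [Exp.subst, Exp.raw, Raw.subst]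
  case var k => exact h k
  case pi a b => rw [a _ _ _ _ h h', b _ _ _ _ (l₁ h) (l₂ h')]
  case lam a b => rw [b _ _ _ _ (l₁ h) (l₂ h')]
  case app a b => rw [a _ _ _ _ h h', b _ _ _ _ h h']
  case sigma a b => rw [a _ _ _ _ h h', b _ _ _ _ (l₁ h) (l₂ h')]
  case pair a b => rw [a _ _ _ _ h h', b _ _ _ _ h h']
  case fst a => rw [a _ _ _ _ h h']
  case snd a => rw [a _ _ _ _ h h']
  case idt a b c => rw [a _ _ _ _ h h', b _ _ _ _ h h', c _ _ _ _ h h']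
  case refl a => rw [a _ _ _ _ h h']
  case elimId a b c =>
    rw [a _ _ _ _ (l₁ (l₁ h)) (l₂ (l₂ h')), b _ _ _ _ h h', c _ _ _ _ h h']
  case base i =>
    rw [rename_subst, rename_eq_subst]
    congr 1
    funext k
    exact (h' k).symm
  case fam a =>
    rw [subst_subst, a _ _ _ _ h h']
    congr 1
    funext k
    cases k with
    | zero => rfl
    | succ k => exact (h' k).symm
  case con i =>
    rw [rename_subst, rename_eq_subst]
    congr 1
    funext k
    exact (h' k).symm

theorem raw_inst (B a : Exp) (n : ℕ) :
    (B.inst a).raw M n = (B.raw M (n + 1)).inst (a.raw M n) := by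
  refine raw_subst M B (n + 1) n _ _ (fun k => ?_) fun k => rfl
  cases k <;> rfl

theorem raw_inst₂ (C b p : Exp) (n : ℕ) :
    (C.inst₂ b p).raw M n = (C.raw M (n + 2)).inst₂ (b.raw M n) (p.raw M n) := by
  refine raw_subst M C (n + 2) n _ _ (fun k => ?_) fun k => rfl
  rcases k with _ | _ | k <;> rfl

/-- The raw context denoted by a telescope over `Γ`. -/
def ctxRaw (Γ : Ctx) : List Exp → Ctx
  | [] => Γ
  | A :: Δ => A.raw M Δ.length :: ctxRaw Γ Δ

end raw

/-- `M` interprets the opaque symbols by well-typed raw expressions over `Γ`, the opaque terms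
having the types listed in `K`. -/
structure Model.Valid (X : Scheme) (M : Model) (Γ : Ctx) (K : ℕ → Option Exp) : Prop where
  ctx : Der X (ctx Γ)
  base : ∀ i, Der X (ty Γ (M.base i))
  fam : Der X (ty (M.base 0 :: Γ) M.fam)
  con : ∀ i T, K i = some T → Der X (ty Γ (T.raw M 0)) ∧ Der X (tm Γ (M.con i) (T.raw M 0))

/-! ### Soundness of the normalizer -/

section sound

variable {X : Scheme} {M : Model} {Γ : Ctx} {K : ℕ → Option Exp}

theorem lookup_shift (Δ : List Exp) {n : ℕ} {A : Raw} (h : Lookup Γ n A) :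
    Lookup (ctxRaw M Γ Δ) (n + Δ.length) (A.rename (· + Δ.length)) := by
  induction Δ with
  | nil =>
    have : A.rename (· + 0) = A := by
      rw [rename_eq_subst]
      exact subst_var A
    rw [List.length_nil, this]
    exact h
  | cons B Δ ih =>
    have := Lookup.succ _ _ _ (B.raw M Δ.length) ih
    rwa [Raw.wk, rename_rename] at this

theorem renameOk_shift {Δ : List Exp} (hΔ : Der X (ctx (ctxRaw M Γ Δ))) :
    RenameOk X (ctxRaw M Γ Δ) (Raw.var ∘ (· + Δ.length)) Γ :=
  ⟨hΔ, _, rfl, fun _ _ h => lookup_shift Δ h⟩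

theorem shift_ty {Δ : List Exp} (hΔ : Der X (ctx (ctxRaw M Γ Δ))) {A : Raw}
    (h : Der X (ty Γ A)) : Der X (ty (ctxRaw M Γ Δ) (A.rename (· + Δ.length))) := by
  rw [rename_eq_subst]
  exact h.stableUnder_renameOk (renameOk_shift hΔ)

theorem shift_tm {Δ : List Exp} (hΔ : Der X (ctx (ctxRaw M Γ Δ))) {a A : Raw}
    (h : Der X (tm Γ a A)) :
    Der X (tm (ctxRaw M Γ Δ) (a.rename (· + Δ.length)) (A.rename (· + Δ.length))) := by
  rw [rename_eq_subst, rename_eq_subst]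
  exact h.stableUnder_renameOk (renameOk_shift hΔ)

theorem substOk_shift {A a : Raw} {Δ : List Exp} (hΔ : Der X (ctx (ctxRaw M Γ Δ)))
    (h : Der X (tm (ctxRaw M Γ Δ) a (A.rename (· + Δ.length)))) :
    SubstOk X (ctxRaw M Γ Δ) (consSub a fun k => .var (k + Δ.length)) (A :: Γ) := by
  refine ⟨hΔ, fun n B hn => ?_⟩
  cases hn with
  | zero =>
    rw [wk_subst_consSub]
    rwa [rename_eq_subst] at h
  | succ _ n B _ hn =>
    rw [wk_subst_consSub]
    have := lookup_shift (M := M) Δ hn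
    rw [rename_eq_subst] at this
    exact .var hΔ this

theorem substEq_shift {A a b : Raw} {Δ : List Exp} (hΔ : Der X (ctx (ctxRaw M Γ Δ)))
    (h : Der X (tm (ctxRaw M Γ Δ) a (A.rename (· + Δ.length))))
    (h' : Der X (tmEq (ctxRaw M Γ Δ) a b (A.rename (· + Δ.length)))) :
    SubstEq X (consSub a fun k => .var (k + Δ.length)) (consSub b fun k => .var (k + Δ.length))
      (ctxRaw M Γ Δ) (A :: Γ) := by
  have := substOk_shift hΔ h
  refine ⟨this, fun n B hn => ?_⟩
  have hv := this.2 n B hn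
  cases hn with
  | zero =>
    rw [wk_subst_consSub]
    rwa [rename_eq_subst] at h'
  | succ _ n B _ hn => exact .tm_refl hv

theorem lookup_sound {Δ : List Exp} (hΔ : Der X (ctx (ctxRaw M Γ Δ))) :
    ∀ {n : ℕ} {T : Exp}, lookup Δ n = some T →
      Lookup (ctxRaw M Γ Δ) n (T.raw M Δ.length) ∧
      Der X (ty (ctxRaw M Γ Δ) (T.raw M Δ.length)) := by
  induction Δ with
  | nil => intro n T h; cases h
  | cons A Δ ih =>
    intro n T h
    obtain ⟨hc, hA⟩ := hΔ.inverted
    cases n with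
    | zero =>
      cases h
      rw [List.length_cons, raw_wk]
      exact ⟨.zero _ _, hA.wk_ty hΔ⟩
    | succ n =>
      simp only [lookup, Option.map_eq_some_iff] at h
      obtain ⟨T, hT, rfl⟩ := h
      obtain ⟨h₁, h₂⟩ := ih hc hT
      rw [List.length_cons, raw_wk]
      exact ⟨.succ _ _ _ _ h₁, h₂.wk_ty hΔ⟩

/-- Typing data carried by constructors in normal form, as needed for computation. -/
def Good (X : Scheme) (M : Model) (Γ : Ctx) (Δ : List Exp) : Exp → Exp → Prop
  | .lam _ b, T => ∃ A B, T = .pi A B ∧ Der X (ty (ctxRaw M Γ Δ) (A.raw M Δ.length)) ∧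
      Der X (tm (ctxRaw M Γ (A :: Δ)) (b.raw M (Δ.length + 1)) (B.raw M (Δ.length + 1)))
  | .pair _ D a b, T => ∃ A B, T = .sigma A B ∧
      Der X (tm (ctxRaw M Γ Δ) (a.raw M Δ.length) (A.raw M Δ.length)) ∧ Good X M Γ Δ a A ∧
      Der X (ty (ctxRaw M Γ Δ) (D.raw M Δ.length)) ∧
      Der X (tm (ctxRaw M Γ Δ) (b.raw M Δ.length) (D.raw M Δ.length)) ∧ Good X M Γ Δ b D ∧
      Der X (tyEq (ctxRaw M Γ Δ) (D.raw M Δ.length)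
        ((B.raw M (Δ.length + 1)).inst (a.raw M Δ.length)))
  | _, _ => True

/-- `r` is a normal form, with its type, of a term denoting `t`. -/
structure TmOk (X : Scheme) (M : Model) (Γ : Ctx) (Δ : List Exp) (t : Raw) (r : Exp × Exp) :
    Prop where
  ty : Der X (ty (ctxRaw M Γ Δ) (r.2.raw M Δ.length))
  tm : Der X (tm (ctxRaw M Γ Δ) (r.1.raw M Δ.length) (r.2.raw M Δ.length))
  eq : Der X (tmEq (ctxRaw M Γ Δ) (r.1.raw M Δ.length) t (r.2.raw M Δ.length))
  good : Good X M Γ Δ r.1 r.2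

/-- `A` is a normal form of a type denoting `T`. -/
structure TyOk (X : Scheme) (M : Model) (Γ : Ctx) (Δ : List Exp) (T : Raw) (A : Exp) :
    Prop where
  ty : Der X (ty (ctxRaw M Γ Δ) (A.raw M Δ.length))
  eq : Der X (tyEq (ctxRaw M Γ Δ) (A.raw M Δ.length) T)

variable (X M Γ) in
/-- Soundness of a normalization function for terms. -/
def SoundTm (nf : List Exp → Exp → Option (Exp × Exp)) : Prop :=
  ∀ {Δ t r}, Der X (ctx (ctxRaw M Γ Δ)) → nf Δ t = some r → TmOk X M Γ Δ (t.raw M Δ.length) r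

variable (X M Γ) in
/-- Soundness of a normalization function for types. -/
def SoundTy (nfT : List Exp → Exp → Option Exp) : Prop :=
  ∀ {Δ T A}, Der X (ctx (ctxRaw M Γ Δ)) → nfT Δ T = some A → TyOk X M Γ Δ (T.raw M Δ.length) A

variable {nf : List Exp → Exp → Option (Exp × Exp)} {nfT : List Exp → Exp → Option Exp}
  {Δ : List Exp}

theorem check_eq_some {α : Type} {c : Bool} {x y : α} (h : check c x = some y) :
    c = true ∧ x = y := by
  cases c
  · cases h
  · exact ⟨rfl, Option.some.inj h⟩

theorem cond_eq_some {α : Type} {c : Bool} {x : Option α} {y : α} (h : cond c x none = some y) :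
    c = true ∧ x = some y := by
  cases c
  · cases h
  · exact ⟨rfl, h⟩

/-- The shortcut checks nothing, so the type must be known to be well-formed beforehand. -/
theorem quickTy_sound (hnfT : SoundTy X M Γ nfT) (hΔ : Der X (ctx (ctxRaw M Γ Δ))) {T R : Exp}
    (hT : Der X (ty (ctxRaw M Γ Δ) (T.raw M Δ.length))) (h : quickTy nfT Δ T = some R) :
    TyOk X M Γ Δ (T.raw M Δ.length) R := by
  unfold quickTy at h
  rcases Bool.eq_false_or_eq_true T.noRedex with hc | hc <;> rw [hc] at h
  · cases h
    exact ⟨hT, .ty_refl hT⟩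
  · exact hnfT hΔ h

theorem good_of_isElim {t T : Exp} (h : t.isElim = true) : Good X M Γ Δ t T := by
  cases t <;> trivial

theorem stepTy_sound (hM : M.Valid X Γ K) (hnf : SoundTm X M Γ nf) (hnfT : SoundTy X M Γ nfT) :
    SoundTy X M Γ (stepTy nf nfT) := by
  intro Δ T R hΔ h
  cases T <;> simp only [stepTy, Option.bind_eq_some_iff, Option.some.injEq, reduceCtorEq] at h
  case pi A B =>
    obtain ⟨A', hA, B', hB, rfl⟩ := h
    have hA := hnfT hΔ hA
    have hB := hnfT (Δ := A' :: Δ) (.ctx_cons hΔ hA.ty) hB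
    exact ⟨.pi_form hA.ty hB.ty, .pi_form_eq hA.ty hA.eq hB.eq⟩
  case sigma A B =>
    obtain ⟨A', hA, B', hB, rfl⟩ := h
    have hA := hnfT hΔ hA
    have hB := hnfT (Δ := A' :: Δ) (.ctx_cons hΔ hA.ty) hB
    exact ⟨.sigma_form hA.ty hB.ty, .sigma_form_eq hA.ty hA.eq hB.eq⟩
  case idt A a b =>
    obtain ⟨A', hA, ⟨a', A₁⟩, ha, ⟨b', A₂⟩, hb, h⟩ := h
    obtain ⟨hc, rfl⟩ := check_eq_some h
    obtain ⟨h₁, h₂⟩ := Bool.and_eq_true_iff.1 hc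
    obtain rfl : A₁ = A' := Exp.eq_of_beq h₁
    obtain rfl : A₂ = A₁ := Exp.eq_of_beq h₂
    have hA := hnfT hΔ hA
    have ha := hnf hΔ ha
    have hb := hnf hΔ hb
    exact ⟨.id_form hA.ty ha.tm hb.tm, .id_form_eq hA.eq ha.eq hb.eq⟩
  case base i =>
    subst h
    have := shift_ty hΔ (hM.base i)
    exact ⟨this, .ty_refl this⟩
  case fam a =>
    obtain ⟨⟨a', A⟩, ha, h⟩ := h
    obtain ⟨hc, rfl⟩ := check_eq_some h
    obtain rfl : A = .base 0 := Exp.eq_of_beq hc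
    have ha := hnf hΔ ha
    exact ⟨hM.fam.stableUnder_substOk (substOk_shift hΔ ha.tm),
      hM.fam.functional (substEq_shift hΔ ha.tm ha.eq)⟩

theorem etaLam_sound (hnf : SoundTm X M Γ nf) (hΔ : Der X (ctx (ctxRaw M Γ Δ)))
    {A B b : Exp} {t : Raw} {r : Exp × Exp}
    (hA : Der X (ty (ctxRaw M Γ Δ) (A.raw M Δ.length)))
    (hb : TmOk X M Γ (A :: Δ) t (b, B)) (h : etaLam nf Δ A B b = some r) :
    TmOk X M Γ Δ (.lam t) r := by
  have key : TmOk X M Γ Δ (.lam t) (.lam A b, .pi A B) :=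
    ⟨.pi_form hA hb.ty, .lam hA hb.tm, .lam_eq hA hb.eq, A, B, rfl, hA, hb.tm⟩
  unfold etaLam at h
  split at h
  · rename_i f
    obtain ⟨⟨g, T⟩, hg, h⟩ := Option.bind_eq_some_iff.1 h
    -- If the test fails, the abstraction itself is returned; both outcomes denote the same
    -- function, by `pi_eta` in the first case.
    rcases Bool.eq_false_or_eq_true ((g, T).1.wk.beq f && (g, T).2.beq (A.pi B)) with hc | hc
    · rw [hc] at h
      cases h
      obtain ⟨h₁, h₂⟩ := Bool.and_eq_true_iff.1 hc
      obtain rfl : g.wk = f := Exp.eq_of_beq h₁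
      obtain rfl : T = .pi A B := Exp.eq_of_beq h₂
      have hg := hnf hΔ hg
      refine ⟨hg.ty, hg.tm, ?_, hg.good⟩
      have := hg.tm.pi_eta
      rw [← raw_wk] at this
      exact this.tm_trans key.eq
    · rw [hc] at h
      cases h
      exact key
  · cases h
    exact key

theorem etaPair_sound (hnf : SoundTm X M Γ nf) (hΔ : Der X (ctx (ctxRaw M Γ Δ)))
    {A B D a b : Exp} {t : Raw} {r : Exp × Exp}
    (key : TmOk X M Γ Δ t (.pair (.sigma A B) D a b, .sigma A B))
    (h : etaPair nf Δ A B D a b = some r) : TmOk X M Γ Δ t r := by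
  unfold etaPair at h
  split at h
  · rename_i p q
    obtain ⟨⟨p', T⟩, hp, h⟩ := Option.bind_eq_some_iff.1 h
    rcases Bool.eq_false_or_eq_true
      ((p', T).1.beq p && p.beq q && (p', T).2.beq (A.sigma B)) with hc | hc
    · rw [hc] at h
      cases h
      obtain ⟨h₁, h₂⟩ := Bool.and_eq_true_iff.1 hc
      obtain ⟨h₀, h₁⟩ := Bool.and_eq_true_iff.1 h₁
      obtain rfl : p' = p := Exp.eq_of_beq h₀
      obtain rfl : p' = q := Exp.eq_of_beq h₁
      obtain rfl : T = .sigma A B := Exp.eq_of_beq h₂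
      have hp := hnf hΔ hp
      exact ⟨hp.ty, hp.tm, hp.tm.sigma_eta.tm_trans key.eq, hp.good⟩
    · rw [hc] at h
      cases h
      exact key
  · cases h
    exact key

theorem appNf_sound (hnf : SoundTm X M Γ nf) (hΔ : Der X (ctx (ctxRaw M Γ Δ)))
    {A B R f a : Exp} {t u : Raw} {r : Exp × Exp}
    (hf : TmOk X M Γ Δ t (f, .pi A B)) (ha : TmOk X M Γ Δ u (a, A))
    (hR : TyOk X M Γ Δ ((B.inst a).raw M Δ.length) R)
    (h : appNf nf Δ R a f = some r) : TmOk X M Γ Δ (.app t u) r := by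
  have hRe := hR.eq.ty_symm
  rw [raw_inst] at hRe
  have key : Der X (tmEq (ctxRaw M Γ Δ) (.app (f.raw M Δ.length) (a.raw M Δ.length)) (.app t u)
      (R.raw M Δ.length)) := (hf.eq.app_eq ha.eq).conv_eq hRe
  unfold appNf at h
  split at h
  · rename_i A₀ b
    -- `Good` provides the typing of the body at the right domain and codomain, in place of
    -- injectivity of `pi`.
    obtain ⟨_, _, hT, hA, hb⟩ := hf.good
    cases hT
    have hβ := ((hA.pi_beta hb ha.tm).conv_eq hRe).tm_symm.tm_trans key
    rcases Bool.eq_false_or_eq_true ((b.inst a).isElim && (b.inst a).noRedex) with hc | hc <;>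
      rw [hc] at h
    · cases h
      rw [← raw_inst] at hβ
      have ht := (hb.inst_tm ha.tm).conv hRe
      rw [← raw_inst] at ht
      exact ⟨hR.ty, ht, hβ, good_of_isElim (Bool.and_eq_true_iff.1 hc).1⟩
    · obtain ⟨⟨q, T⟩, hq, h⟩ := Option.bind_eq_some_iff.1 h
      obtain ⟨hc, rfl⟩ := check_eq_some h
      obtain rfl : T = R := Exp.eq_of_beq hc
      have hq := hnf hΔ hq
      have := hq.eq
      rw [raw_inst] at this
      exact ⟨hq.ty, hq.tm, this.tm_trans hβ, hq.good⟩
  · cases h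
    refine ⟨hR.ty, (hf.tm.app ha.tm).conv hRe, key, ?_⟩
    trivial

theorem fstNf_sound {A B p : Exp} {t : Raw} (hp : TmOk X M Γ Δ t (p, .sigma A B)) :
    TmOk X M Γ Δ (.fst t) (fstNf p, A) := by
  obtain ⟨hA, hB⟩ := hp.ty.inverted
  unfold fstNf
  split
  · rename_i S D a b
    obtain ⟨_, _, hT, ha, ga, -, hb, -, hD⟩ := hp.good
    cases hT
    exact ⟨hA, ha, (hA.fst_beta hB ha (hb.conv hD)).tm_symm.tm_trans hp.eq.fst_eq, ga⟩
  · refine ⟨hA, hp.tm.fst, hp.eq.fst_eq, ?_⟩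
    trivial

theorem sndNf_sound (hnfT : SoundTy X M Γ nfT) (hΔ : Der X (ctx (ctxRaw M Γ Δ)))
    {A B p : Exp} {t : Raw} {r : Exp × Exp} (hp : TmOk X M Γ Δ t (p, .sigma A B))
    (h : sndNf nfT Δ B p = some r) : TmOk X M Γ Δ (.snd t) r := by
  obtain ⟨hA, hB⟩ := hp.ty.inverted
  have key := hp.eq.snd_eq
  unfold sndNf at h
  split at h
  · rename_i S D a b
    cases h
    obtain ⟨_, _, hT, ha, -, hD, hb, gb, hDe⟩ := hp.good
    cases hT
    have hb' := hb.conv hDe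
    -- The congruence `key` lives over `B[fst (a, b)]` and the `β` rule over `B[a]`; functionality
    -- of `B` joins them.
    have hβ := hB.inst_congr hp.tm.fst (hA.fst_beta hB ha hb')
    exact ⟨hD, hb, ((hA.snd_beta hB ha hb').tm_symm.tm_trans (key.conv_eq hβ)).conv_eq
      hDe.ty_symm, gb⟩
  · obtain ⟨D, hD, h⟩ := Option.bind_eq_some_iff.1 h
    cases h
    have hBt := hB.inst_ty hp.tm.fst
    rw [← Exp.raw, ← raw_inst] at hBt
    have hD := quickTy_sound hnfT hΔ hBt hD
    have hDe := hD.eq.ty_symm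
    rw [raw_inst] at hDe
    refine ⟨hD.ty, hp.tm.snd.conv hDe, key.conv_eq hDe, ?_⟩
    trivial

theorem elimNf_sound (hnfT : SoundTy X M Γ nfT) (hΔ : Der X (ctx (ctxRaw M Γ Δ)))
    {A a b C d D p : Exp} {C₀ d₀ p₀ : Raw} {r : Exp × Exp}
    (hp : TmOk X M Γ Δ p₀ (p, .idt A a b))
    (hC : TyOk X M Γ (.idt A.wk a.wk (.var 0) :: A :: Δ) C₀ C)
    (hD : TyOk X M Γ Δ ((C.inst₂ a (.refl a)).raw M Δ.length) D)
    (hd : TmOk X M Γ Δ d₀ (d, D))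
    (h : elimNf nfT Δ a b C d D p = some r) : TmOk X M Γ Δ (.elimId C₀ d₀ p₀) r := by
  obtain ⟨hA, ha, hb⟩ := hp.ty.inverted
  have hCt := hC.ty
  have hCe := hC.eq
  simp only [ctxRaw, Exp.raw, raw_wk, List.length_cons] at hCt hCe
  have hDe := hD.eq
  rw [raw_inst₂] at hDe
  have key := Der.elimId_eq hA ha hCe (hd.eq.conv_eq hDe) hb hp.eq
  unfold elimNf at h
  split at h
  · rename_i c
    obtain ⟨hc, rfl⟩ := check_eq_some h
    obtain ⟨h₁, h₂⟩ := Bool.and_eq_true_iff.1 hc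
    obtain rfl : c = a := Exp.eq_of_beq h₁
    obtain rfl : b = c := Exp.eq_of_beq h₂
    refine ⟨hD.ty, hd.tm, ?_, hd.good⟩
    exact (((hA.id_beta ha hCt (hd.tm.conv hDe)).tm_symm.tm_trans key).conv_eq hDe.ty_symm)
  · obtain ⟨R, hR, h⟩ := Option.bind_eq_some_iff.1 h
    cases h
    have hR := quickTy_sound hnfT hΔ (by
      rw [raw_inst₂]
      exact hCt.inst₂_ty hb hp.tm) hR
    have hRe := hR.eq.ty_symm
    rw [raw_inst₂] at hRe
    refine ⟨hR.ty, (hA.elimId ha hCt (hd.tm.conv hDe) hb hp.tm).conv hRe, key.conv_eq hRe, ?_⟩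
    trivial

theorem stepTm_sound (hM : M.Valid X Γ K) (hnf : SoundTm X M Γ nf) (hnfT : SoundTy X M Γ nfT) :
    SoundTm X M Γ (stepTm K nf nfT) := by
  intro Δ t r hΔ h
  cases t <;> simp only [stepTm, Option.bind_eq_some_iff, Option.some.injEq, reduceCtorEq] at h
  case var n =>
    obtain ⟨T, hT, rfl⟩ := h
    obtain ⟨h₁, h₂⟩ := lookup_sound hΔ hT
    exact ⟨h₂, .var hΔ h₁, .tm_refl (.var hΔ h₁), trivial⟩
  case con i =>
    obtain ⟨T, hT, rfl⟩ := h
    obtain ⟨h₁, h₂⟩ := hM.con i T hT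
    have e : (T.rename (· + Δ.length)).raw M Δ.length = (T.raw M 0).rename (· + Δ.length) :=
      raw_rename M T 0 _ _ fun _ => rfl
    have h₁ := shift_ty hΔ h₁
    have h₂ := shift_tm hΔ h₂
    rw [← e] at h₁ h₂
    exact ⟨h₁, h₂, .tm_refl h₂, trivial⟩
  case lam A b =>
    obtain ⟨A', hA, ⟨b', B⟩, hb, h⟩ := h
    have hA := hnfT hΔ hA
    exact etaLam_sound hnf hΔ hA.ty (hnf (Δ := A' :: Δ) (.ctx_cons hΔ hA.ty) hb) h
  case app f a =>
    obtain ⟨⟨f', T⟩, hf, ⟨a', A⟩, ha, h⟩ := h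
    split at h
    · rename_i A₁ B hT
      obtain rfl : T = .pi A₁ B := hT
      obtain ⟨hc, h⟩ := cond_eq_some h
      obtain rfl : A = A₁ := Exp.eq_of_beq hc
      obtain ⟨R, hR, h⟩ := Option.bind_eq_some_iff.1 h
      have hf := hnf hΔ hf
      have ha := hnf hΔ ha
      refine appNf_sound hnf hΔ hf ha (quickTy_sound hnfT hΔ ?_ hR) h
      rw [raw_inst]
      exact hf.ty.inverted.2.inst_ty ha.tm
    · cases h
  case pair S D a b =>
    obtain ⟨S', hS, ⟨a', A⟩, ha, ⟨b', D'⟩, hb, h⟩ := h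
    split at h
    · rename_i A₁ B
      obtain ⟨D₁, hD, h⟩ := Option.bind_eq_some_iff.1 h
      obtain ⟨hc, h⟩ := cond_eq_some h
      obtain ⟨h₁, h₂⟩ := Bool.and_eq_true_iff.1 hc
      obtain rfl : A = A₁ := Exp.eq_of_beq h₁
      obtain rfl : D' = D₁ := Exp.eq_of_beq h₂
      have hS := hnfT hΔ hS
      have ha := hnf hΔ ha
      have hb := hnf hΔ hb
      obtain ⟨hA, hB⟩ := hS.ty.inverted
      have hD := quickTy_sound hnfT hΔ (by
        rw [raw_inst]
        exact hB.inst_ty ha.tm) hD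
      have hDe := hD.eq
      rw [raw_inst] at hDe
      exact etaPair_sound hnf hΔ ⟨hS.ty, hA.pair hB ha.tm (hb.tm.conv hDe),
        hA.pair_eq hB ha.eq (hb.eq.conv_eq hDe), A, B, rfl, ha.tm, ha.good, hD.ty, hb.tm, hb.good,
        hDe⟩ h
    · cases h
  case fst p =>
    obtain ⟨⟨p', T⟩, hp, h⟩ := h
    split at h
    · rename_i A B hT
      obtain rfl : T = .sigma A B := hT
      cases h
      exact fstNf_sound (hnf hΔ hp)
    · cases h
  case snd p =>
    obtain ⟨⟨p', T⟩, hp, h⟩ := h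
    split at h
    · rename_i A B hT
      obtain rfl : T = .sigma A B := hT
      exact sndNf_sound hnfT hΔ (hnf hΔ hp) h
    · cases h
  case refl a =>
    obtain ⟨⟨a', A⟩, ha, rfl⟩ := h
    have ha := hnf hΔ ha
    exact ⟨ha.ty.id_form ha.tm ha.tm, ha.tm.refl, ha.eq.refl_eq, trivial⟩
  case elimId C d p =>
    obtain ⟨⟨p', T⟩, hp, h⟩ := h
    split at h
    · rename_i A a b hT
      obtain rfl : T = .idt A a b := hT
      obtain ⟨C', hC, h⟩ := Option.bind_eq_some_iff.1 h
      obtain ⟨D, hD, h⟩ := Option.bind_eq_some_iff.1 h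
      obtain ⟨⟨d', D'⟩, hd, h⟩ := Option.bind_eq_some_iff.1 h
      obtain ⟨hc, h⟩ := cond_eq_some h
      obtain rfl : D' = D := Exp.eq_of_beq hc
      have hp := hnf hΔ hp
      obtain ⟨hA, ha, -⟩ := hp.ty.inverted
      have hAc : Der X (ctx (ctxRaw M Γ (A :: Δ))) := .ctx_cons hΔ hA
      have hI : Der X (ctx (ctxRaw M Γ (.idt A.wk a.wk (.var 0) :: A :: Δ))) := by
        refine .ctx_cons hAc ?_
        simp only [Exp.raw, List.length_cons, raw_wk]
        exact .id_form (hA.wk_ty hAc) (ha.wk_tm hAc) (.var hAc (.zero _ _))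
      have hC := hnfT hI hC
      have hCt := hC.ty
      simp only [ctxRaw, Exp.raw, raw_wk, List.length_cons] at hCt
      refine elimNf_sound hnfT hΔ hp hC (quickTy_sound hnfT hΔ ?_ hD) (hnf hΔ hd) h
      rw [raw_inst₂]
      exact hCt.inst₂_ty ha ha.refl
    · cases h

theorem norm_sound (hM : M.Valid X Γ K) (n : ℕ) :
    SoundTm X M Γ (norm K n).1 ∧ SoundTy X M Γ (norm K n).2 := by
  induction n with
  | zero => constructor <;> intro _ _ _ _ h <;> cases h
  | succ n ih => exact ⟨stepTm_sound hM ih.1 ih.2, stepTy_sound hM ih.1 ih.2⟩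

/-- The inhabitant is the normal form of `t`, not `t` itself. -/
theorem inhabited_of_hasType (hM : M.Valid X Γ K) {t T : Exp} (h : hasType K t T = true) :
    Inhabited X Γ (T.raw M 0) := by
  unfold hasType at h
  obtain ⟨hnf, hnfT⟩ := norm_sound hM 1000
  split at h
  · rename_i r S hr hS
    have hc : Der X (ctx (ctxRaw M Γ [])) := hM.ctx
    obtain ⟨t', T'⟩ := r
    obtain rfl : T' = S := Exp.eq_of_beq h
    exact ⟨_, (hnf hc hr).tm.conv (hnfT hc hS).eq⟩
  · cases h

theorem ty_of_isTy (hM : M.Valid X Γ K) (hΔ : Der X (ctx (ctxRaw M Γ Δ))) {T : Exp}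
    (h : isTy K Δ T = true) : Der X (ty (ctxRaw M Γ Δ) (T.raw M Δ.length)) := by
  unfold isTy at h
  split at h
  · rename_i T' hT
    obtain rfl : T' = T := Exp.eq_of_beq h
    exact ((norm_sound hM 1000).2 hΔ hT).ty
  · cases h

/-- Here the judgment concerns `t` itself, because `t` is an argument of one of the principles; for
this reason it has to be normal already. -/
theorem tm_of_isTm (hM : M.Valid X Γ K) (hΔ : Der X (ctx (ctxRaw M Γ Δ))) {t T : Exp}
    (h : isTm K Δ t T = true) :
    Der X (tm (ctxRaw M Γ Δ) (t.raw M Δ.length) (T.raw M Δ.length)) := by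
  unfold isTm at h
  split at h
  · rename_i r hr
    obtain ⟨t', T'⟩ := r
    obtain ⟨h₁, h₂⟩ := Bool.and_eq_true_iff.1 h
    obtain rfl : t' = t := Exp.eq_of_beq h₁
    obtain rfl : T' = T := Exp.eq_of_beq h₂
    exact ((norm_sound hM 1000).1 hΔ hr).tm
  · cases h

end sound

namespace Exp

/-! ## The notions of type theory on expressions -/

/-- The function type. -/
def arr (A B : Exp) : Exp := pi A B.wk

/-- The product type. -/
def prod (A B : Exp) : Exp := sigma A B.wk

/-- The identity function of `A`. -/
def idFun (A : Exp) : Exp := lam A (var 0)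

/-- The composite `g ∘ f`, where `f` has domain `A`. -/
def comp (A g f : Exp) : Exp := lam A (app g.wk (app f.wk (var 0)))

/-- Post-composition `(Z → A) → (Z → B)` with `f`. -/
def postComp (Z A f : Exp) : Exp := lam (arr Z A) (comp Z.wk f.wk (var 0))

/-- Homotopies. -/
def htpy (A B f g : Exp) : Exp := pi A (idt B (app f.wk (var 0)) (app g.wk (var 0)))

/-- Homotopy sections. -/
def hSec (A B f : Exp) : Exp :=
  sigma (arr B A) (htpy B.wk B.wk.wk (comp B.wk f.wk (var 0)) (idFun B.wk))

/-- Homotopy retractions. -/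
def hRet (A B f : Exp) : Exp :=
  sigma (arr B A) (htpy A.wk A.wk.wk (comp A.wk (var 0) f.wk) (idFun A.wk))

/-- Being an equivalence. -/
def isEquiv (A B f : Exp) : Exp := prod (hSec A B f) (hRet A B f)

/-- Homotopy equivalences. -/
def hEquiv (A B : Exp) : Exp := sigma (arr A B) (isEquiv A.wk B.wk (var 0))

/-- Sections up to identity. -/
def cSec (A B f : Exp) : Exp :=
  sigma (arr B A) (idt (arr B B).wk (comp B.wk f.wk (var 0)) (idFun B.wk))

/-- Retractions up to identity. -/
def cRet (A B f : Exp) : Exp :=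
  sigma (arr B A) (idt (arr A A).wk (comp A.wk (var 0) f.wk) (idFun A.wk))

/-- Being a categorical equivalence. -/
def isCEq (A B f : Exp) : Exp := prod (cSec A B f) (cRet A B f)

/-- Categorical equivalences. -/
def cEquiv (A B : Exp) : Exp := sigma (arr A B) (isCEq A.wk B.wk (var 0))

/-- The map `(f = g) → (f ∼ g)`. -/
def happly (A B f g : Exp) : Exp :=
  lam (idt (pi A B) f g) (elimId
    (htpy (A.rename (· + 3)) (B.rename (liftRen (· + 3))) (f.rename (· + 3)) (var 1))
    (lam A.wk (refl (app f.wk.wk (var 0))))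
    (var 0))

/-- The map `(A ≅ B) → (A ≃ B)`. -/
def cEquivToHEquiv (A B : Exp) : Exp :=
  let f := fst (var 0)
  let s := fst (fst (snd (var 0)))
  let p := snd (fst (snd (var 0)))
  let r := fst (snd (snd (var 0)))
  let q := snd (snd (snd (var 0)))
  let S := isEquiv A.wk B.wk f
  let S₁ := hSec A.wk B.wk f
  let S₂ := hRet A.wk B.wk f
  lam (cEquiv A B) (pair (hEquiv A B).wk S f (pair S S₂
    (pair S₁ S₁ s (app (happly B.wk B.wk.wk (comp B.wk f s) (idFun B.wk)) p))
    (pair S₂ S₂ r (app (happly A.wk A.wk.wk (comp A.wk r f) (idFun A.wk)) q))))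

/-- Being a proposition. -/
def isProp (T : Exp) : Exp := pi T (pi T.wk (idt T.wk.wk (var 1) (var 0)))

/-- Being contractible. -/
def isContr (T : Exp) : Exp := sigma T (pi T.wk (idt T.wk.wk (var 1) (var 0)))

section raw

variable (M : Model) (n : ℕ) (A B Z f g : Exp)

@[simp]
theorem raw_arr : (arr A B).raw M n = ITT.arr (A.raw M n) (B.raw M n) := by
  simp only [arr, raw, raw_wk, ITT.arr]

@[simp]
theorem raw_prod : (prod A B).raw M n = ITT.prod (A.raw M n) (B.raw M n) := by
  simp only [prod, raw, raw_wk, ITT.prod]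

@[simp]
theorem raw_idFun : (idFun A).raw M n = ITT.idFun := rfl

@[simp]
theorem raw_comp : (comp A g f).raw M n = ITT.comp (g.raw M n) (f.raw M n) := by
  simp only [comp, raw, raw_wk, ITT.comp]

@[simp]
theorem raw_postComp : (postComp Z A f).raw M n = ITT.postComp (f.raw M n) := by
  simp only [postComp, raw, raw_wk, raw_comp, ITT.postComp]

@[simp]
theorem raw_htpy : (htpy A B f g).raw M n =
    ITT.htpy (A.raw M n) (B.raw M (n + 1)) (f.raw M n) (g.raw M n) := by
  simp only [htpy, raw, raw_wk, ITT.htpy]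

@[simp]
theorem raw_hSec : (hSec A B f).raw M n = ITT.hSec (A.raw M n) (B.raw M n) (f.raw M n) := by
  simp only [hSec, raw, raw_wk, raw_arr, raw_htpy, raw_comp, raw_idFun, ITT.hSec]

@[simp]
theorem raw_hRet : (hRet A B f).raw M n = ITT.hRet (A.raw M n) (B.raw M n) (f.raw M n) := by
  simp only [hRet, raw, raw_wk, raw_arr, raw_htpy, raw_comp, raw_idFun, ITT.hRet]

@[simp]
theorem raw_isEquiv :
    (isEquiv A B f).raw M n = ITT.isEquiv (A.raw M n) (B.raw M n) (f.raw M n) := by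
  simp only [isEquiv, raw_prod, raw_hSec, raw_hRet, ITT.isEquiv]

@[simp]
theorem raw_hEquiv : (hEquiv A B).raw M n = ITT.hEquiv (A.raw M n) (B.raw M n) := by
  simp only [hEquiv, raw, raw_wk, raw_arr, raw_isEquiv, ITT.hEquiv]

@[simp]
theorem raw_cSec : (cSec A B f).raw M n = ITT.cSec (A.raw M n) (B.raw M n) (f.raw M n) := by
  simp only [cSec, raw, raw_wk, raw_arr, raw_comp, raw_idFun, ITT.cSec]

@[simp]
theorem raw_cRet : (cRet A B f).raw M n = ITT.cRet (A.raw M n) (B.raw M n) (f.raw M n) := by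
  simp only [cRet, raw, raw_wk, raw_arr, raw_comp, raw_idFun, ITT.cRet]

@[simp]
theorem raw_isCEq : (isCEq A B f).raw M n = ITT.isCEq (A.raw M n) (B.raw M n) (f.raw M n) := by
  simp only [isCEq, raw_prod, raw_cSec, raw_cRet, ITT.isCEq]

@[simp]
theorem raw_cEquiv : (cEquiv A B).raw M n = ITT.cEquiv (A.raw M n) (B.raw M n) := by
  simp only [cEquiv, raw, raw_wk, raw_arr, raw_isCEq, ITT.cEquiv]

@[simp]
theorem raw_happly : (happly A B f g).raw M n =
    ITT.happly (A.raw M n) (B.raw M (n + 1)) (f.raw M n) := by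
  have h : ∀ k, (k + n) + 3 = k + (n + 1 + 2) := fun k => by omega
  simp only [happly, raw, raw_wk, raw_htpy, ITT.happly, raw_rename M A n (n + 1 + 2) (· + 3) h,
    raw_rename M f n (n + 1 + 2) (· + 3) h,
    raw_rename M B (n + 1) (n + 1 + 2 + 1) (liftRen (· + 3)) fun k => congrArg (· + 1) (h k)]

@[simp]
theorem raw_cEquivToHEquiv : (cEquivToHEquiv A B).raw M n =
    ITT.cEquivToHEquiv (A.raw M n) (B.raw M n) := by
  simp only [cEquivToHEquiv, raw, raw_wk, raw_happly, raw_comp, ITT.cEquivToHEquiv]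

@[simp]
theorem raw_isProp : (isProp A).raw M n = ITT.isProp (A.raw M n) := by
  simp only [isProp, raw, raw_wk, ITT.isProp]

@[simp]
theorem raw_isContr : (isContr A).raw M n = ITT.isContr (A.raw M n) := by
  simp only [isContr, raw, raw_wk, ITT.isContr]

end raw

end Exp

end ITT

namespace ITT

open Judgment

/-! ## Expressions in higher-order abstract syntax -/

/-- An expression as a function of the number of variables in the context. -/
abbrev Hoas := ℕ → Exp

namespace Hoas

/-- The variable bound at depth `l`. -/
@[simp]
def var (l : ℕ) : Hoas := fun d => .var (d - l - 1)

/-- Instantiate an expression with a bound variable. -/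
@[simp]
def bind (b : Hoas → Hoas) : Hoas := fun d => b (var d) (d + 1)

@[simp]
def pi (A : Hoas) (B : Hoas → Hoas) : Hoas := fun d => .pi (A d) (bind B d)
@[simp]
def lam (A : Hoas) (b : Hoas → Hoas) : Hoas := fun d => .lam (A d) (bind b d)
@[simp]
def app (f a : Hoas) : Hoas := fun d => .app (f d) (a d)
@[simp]
def sigma (A : Hoas) (B : Hoas → Hoas) : Hoas := fun d => .sigma (A d) (bind B d)
def pair (S a b : Hoas) : Hoas := fun d => .pair (S d) (S d) (a d) (b d)
@[simp]
def fst (p : Hoas) : Hoas := fun d => .fst (p d)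
@[simp]
def snd (p : Hoas) : Hoas := fun d => .snd (p d)
@[simp]
def idt (A a b : Hoas) : Hoas := fun d => .idt (A d) (a d) (b d)
@[simp]
def refl (a : Hoas) : Hoas := fun d => .refl (a d)
def ind (C : Hoas → Hoas → Hoas) (d p : Hoas) : Hoas :=
  fun n => .elimId (bind (fun x => bind (C x)) n) (d n) (p n)
@[simp]
def base (i : ℕ) : Hoas := fun _ => .base i
@[simp]
def fam (a : Hoas) : Hoas := fun d => .fam (a d)
@[simp]
def con (i : ℕ) : Hoas := fun _ => .con i

@[simp]
def arr (A B : Hoas) : Hoas := fun d => .arr (A d) (B d)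
@[simp]
def idFun (A : Hoas) : Hoas := fun d => .idFun (A d)
@[simp]
def comp (A g f : Hoas) : Hoas := fun d => .comp (A d) (g d) (f d)
@[simp]
def postComp (Z A f : Hoas) : Hoas := fun d => .postComp (Z d) (A d) (f d)
@[simp]
def htpy (A : Hoas) (B : Hoas → Hoas) (f g : Hoas) : Hoas :=
  fun d => .htpy (A d) (bind B d) (f d) (g d)
@[simp]
def hSec (A B f : Hoas) : Hoas := fun d => .hSec (A d) (B d) (f d)
@[simp]
def hRet (A B f : Hoas) : Hoas := fun d => .hRet (A d) (B d) (f d)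
@[simp]
def isEquiv (A B f : Hoas) : Hoas := fun d => .isEquiv (A d) (B d) (f d)
@[simp]
def hEquiv (A B : Hoas) : Hoas := fun d => .hEquiv (A d) (B d)
@[simp]
def cSec (A B f : Hoas) : Hoas := fun d => .cSec (A d) (B d) (f d)
@[simp]
def cRet (A B f : Hoas) : Hoas := fun d => .cRet (A d) (B d) (f d)
@[simp]
def isCEq (A B f : Hoas) : Hoas := fun d => .isCEq (A d) (B d) (f d)
@[simp]
def cEquiv (A B : Hoas) : Hoas := fun d => .cEquiv (A d) (B d)
@[simp]
def happly (A : Hoas) (B : Hoas → Hoas) (f g : Hoas) : Hoas :=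
  fun d => .happly (A d) (bind B d) (f d) (g d)
@[simp]
def cEquivToHEquiv (A B : Hoas) : Hoas := fun d => .cEquivToHEquiv (A d) (B d)
@[simp]
def isProp (T : Hoas) : Hoas := fun d => .isProp (T d)
@[simp]
def isContr (T : Hoas) : Hoas := fun d => .isContr (T d)

/-- The element of `isEquiv f` given by a section and a retraction. -/
def equivMk (A B f s p r q : Hoas) : Hoas :=
  pair (isEquiv A B f) (pair (hSec A B f) s p) (pair (hRet A B f) r q)

/-- The action of the function `f`, with values in `B`, on a path `p` that starts at `x`. -/
def ap (B : Hoas) (f : Hoas → Hoas) (x p : Hoas) : Hoas :=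
  ind (fun y _ => idt B (f x) (f y)) (refl (f x)) p

/-- The inverse of a path `p` that starts at `x`. -/
def symm (A x p : Hoas) : Hoas := ind (fun y _ => idt A y x) (refl x) p

/-- The concatenation of a path `p` that starts at `x` with a path `q`. -/
def trans (A x p q : Hoas) : Hoas := ind (fun y _ => idt A x y) p q

/-- For paths `p : x = y` and `q : x = z`, the path `y = z`. -/
def cmp (A p q z : Hoas) : Hoas := ind (fun y _ => idt A y z) q p

/-- Transport of `u` along `p` in the family `P`. -/
def transport (P : Hoas → Hoas) (p u : Hoas) : Hoas := ind (fun y _ => P y) u p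

end Hoas

/-! ## Applying the checker -/

section apply

variable {X : Scheme} {M : Model} {Γ : Ctx} {K : ℕ → Option Exp}

/-- This is how a principle enters the checker: its instance becomes the domain of a checked
function, which is then applied to the unknown inhabitant. -/
theorem Inhabited.mp {T U t : Exp} (hT : Inhabited X Γ (T.raw M 0)) (hM : M.Valid X Γ K)
    (h : hasType K t (.arr T U) = true) : Inhabited X Γ (U.raw M 0) := by
  obtain ⟨f, hf⟩ := inhabited_of_hasType hM h
  obtain ⟨a, ha⟩ := hT
  rw [Exp.raw_arr] at hf
  have := hf.app ha
  rw [Raw.wk_inst] at this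
  exact ⟨_, this⟩

theorem Inhabited.mp₂ {S T U t : Exp} (hS : Inhabited X Γ (S.raw M 0))
    (hT : Inhabited X Γ (T.raw M 0)) (hM : M.Valid X Γ K)
    (h : hasType K t (.arr S (.arr T U)) = true) : Inhabited X Γ (U.raw M 0) := by
  obtain ⟨f, hf⟩ := hS.mp hM h
  obtain ⟨a, ha⟩ := hT
  rw [Exp.raw_arr] at hf
  have := hf.app ha
  rw [Raw.wk_inst] at this
  exact ⟨_, this⟩

theorem ctx_of_isTy (hM : M.Valid X Γ K) {D : Exp} (hD : isTy K [] D = true) :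
    Der X (ctx (ctxRaw M Γ [D])) :=
  .ctx_cons hM.ctx (ty_of_isTy hM (Δ := []) hM.ctx hD)

/-- An instance of a principle in an extended context is turned into a dependent function over the
original one. -/
theorem inhabited_pi {D T : Exp} (hD : Der X (ctx (ctxRaw M Γ [D])))
    (h : Inhabited X (ctxRaw M Γ [D]) (T.raw M 1)) : Inhabited X Γ ((Exp.pi D T).raw M 0) := by
  obtain ⟨t, ht⟩ := h
  exact ⟨_, .lam hD.inverted.2 ht⟩

/-- The normal form of a closed type. -/
def normTy (K : ℕ → Option Exp) (T : Exp) : Exp := ((norm K 1000).2 [] T).getD T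

end apply

/-! ## Models -/

/-- The model given by three types, a family over the first, and two terms. -/
def Model.of (A B Z P f g : Raw) : Model where
  base := fun
    | 0 => A
    | 1 => B
    | _ => Z
  fam := P
  con := fun
    | 0 => f
    | _ => g

/-- A signature with at most two opaque terms. -/
def sig (S T : Option Exp) : ℕ → Option Exp
  | 0 => S
  | 1 => T
  | _ => none

/-- The signature of a map `base 0 → base 0`. -/
def sigEnd : ℕ → Option Exp := sig (some (.arr (.base 0) (.base 0))) none

/-- The signature of a map `base 0 → base 1`. -/
def sigMap : ℕ → Option Exp := sig (some (.arr (.base 0) (.base 1))) none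

/-- The signature of two sections of the opaque family. -/
def sigSections : ℕ → Option Exp :=
  sig (some (.pi (.base 0) (.fam (.var 0)))) (some (.pi (.base 0) (.fam (.var 0))))

section models

variable {X : Scheme} {Γ : Ctx} {A B Z P f g : Raw}

@[simp]
theorem base_zero : (Model.of A B Z P f g).base 0 = A := rfl

@[simp]
theorem base_one : (Model.of A B Z P f g).base 1 = B := rfl

@[simp]
theorem base_two : (Model.of A B Z P f g).base 2 = Z := rfl

@[simp]
theorem fam_of : (Model.of A B Z P f g).fam = P := rfl

@[simp]
theorem con_zero : (Model.of A B Z P f g).con 0 = f := rfl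

@[simp]
theorem con_one : (Model.of A B Z P f g).con 1 = g := rfl

@[simp]
theorem raw_var (M : Model) (k n : ℕ) : (Exp.var k).raw M n = .var k := rfl

@[simp]
theorem raw_pi (M : Model) (A B : Exp) (n : ℕ) :
    (Exp.pi A B).raw M n = .pi (A.raw M n) (B.raw M (n + 1)) := rfl

@[simp]
theorem raw_app (M : Model) (f a : Exp) (n : ℕ) :
    (Exp.app f a).raw M n = .app (f.raw M n) (a.raw M n) := rfl

@[simp]
theorem raw_sigma (M : Model) (A B : Exp) (n : ℕ) :
    (Exp.sigma A B).raw M n = .sigma (A.raw M n) (B.raw M (n + 1)) := rfl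

@[simp]
theorem raw_idt (M : Model) (A a b : Exp) (n : ℕ) :
    (Exp.idt A a b).raw M n = .idt (A.raw M n) (a.raw M n) (b.raw M n) := rfl

@[simp]
theorem rename_zero (A : Raw) : (A.rename fun k => k) = A := by
  rw [Raw.rename_eq_subst]
  exact Raw.subst_var A

@[simp]
theorem rename_one (A : Raw) : (A.rename fun k => k + 1) = A.wk := rfl

@[simp]
theorem rename_two (A : Raw) : (A.rename fun k => k + 2) = A.wk.wk := by
  rw [Raw.wk, Raw.wk, Raw.rename_rename]
  rfl

@[simp]
theorem raw_base (M : Model) (i n : ℕ) :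
    (Exp.base i).raw M n = (M.base i).rename fun k => k + n := rfl

@[simp]
theorem raw_con (M : Model) (i n : ℕ) : (Exp.con i).raw M n = (M.con i).rename fun k => k + n := rfl

@[simp]
theorem raw_fam (M : Model) : (Exp.fam (.var 0)).raw M 1 = M.fam := by
  conv_rhs => rw [← Raw.subst_var M.fam]
  rw [Exp.raw.eq_13]
  congr 1
  funext k
  cases k <;> rfl

theorem valid_of {S T : Option Exp} (hA : Der X (ty Γ A)) (hB : Der X (ty Γ B))
    (hZ : Der X (ty Γ Z)) (hP : Der X (ty (A :: Γ) P))
    (hf : ∀ U, S = some U → Der X (ty Γ (U.raw (.of A B Z P f g) 0)) ∧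
      Der X (tm Γ f (U.raw (.of A B Z P f g) 0)))
    (hg : ∀ U, T = some U → Der X (ty Γ (U.raw (.of A B Z P f g) 0)) ∧
      Der X (tm Γ g (U.raw (.of A B Z P f g) 0))) :
    (Model.of A B Z P f g).Valid X Γ (sig S T) where
  ctx := hA.context
  base
    | 0 => hA
    | 1 => hB
    | _ + 2 => hZ
  fam := hP
  con
    | 0 => hf
    | 1 => hg
    | _ + 2 => fun _ h => by cases h

theorem arr_form (hA : Der X (ty Γ A)) (hB : Der X (ty Γ B)) : Der X (ty Γ (arr A B)) :=
  .pi_form hA (hB.wk_ty (.ctx_cons hA.context hA))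

/-- Slots of the model that play no role get arbitrary fillers; an entry `none` in the signature
keeps the checker from using the corresponding term. -/
theorem valid_types (hA : Der X (ty Γ A)) (hB : Der X (ty Γ B)) :
    (Model.of A B B .unit .star .star).Valid X Γ (sig none none) :=
  valid_of hA hB hB (.unit_form (.ctx_cons hA.context hA)) (fun _ h => by cases h)
    (fun _ h => by cases h)

theorem valid_end (hA : Der X (ty Γ A)) (hf : Der X (tm Γ f (arr A A))) :
    (Model.of A A A .unit f .star).Valid X Γ sigEnd := by
  refine valid_of hA hA hA (.unit_form (.ctx_cons hA.context hA)) (fun U h => ?_)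
    (fun _ h => by cases h)
  cases h
  simp only [Exp.raw_arr, raw_base, add_zero, rename_zero]
  exact ⟨arr_form hA hA, hf⟩

theorem valid_map (hA : Der X (ty Γ A)) (hB : Der X (ty Γ B)) (hZ : Der X (ty Γ Z))
    (hf : Der X (tm Γ f (arr A B))) : (Model.of A B Z .unit f .star).Valid X Γ sigMap := by
  refine valid_of hA hB hZ (.unit_form (.ctx_cons hA.context hA)) (fun U h => ?_)
    (fun _ h => by cases h)
  cases h
  simp only [Exp.raw_arr, raw_base, add_zero, rename_zero]
  exact ⟨arr_form hA hB, hf⟩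

theorem valid_fam (hA : Der X (ty Γ A)) (hP : Der X (ty (A :: Γ) P)) :
    (Model.of A A A P .star .star).Valid X Γ (sig none none) :=
  valid_of hA hA hA hP (fun _ h => by cases h) (fun _ h => by cases h)

theorem valid_sections (hA : Der X (ty Γ A)) (hP : Der X (ty (A :: Γ) P))
    (hf : Der X (tm Γ f (.pi A P))) (hg : Der X (tm Γ g (.pi A P))) :
    (Model.of A A A P f g).Valid X Γ sigSections := by
  have e : (Exp.pi (.base 0) (.fam (.var 0))).raw (Model.of A A A P f g) 0 = .pi A P := by
    simp only [raw_pi, raw_base, add_zero, rename_zero, zero_add, raw_fam, base_zero, fam_of]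
  refine valid_of hA hA hA hP (fun U h => ?_) (fun U h => ?_) <;> cases h <;> rw [e]
  · exact ⟨.pi_form hA hP, hf⟩
  · exact ⟨.pi_form hA hP, hg⟩

end models

end ITT

namespace ITT

open Judgment

/-! ## The implications -/

namespace Hoas

/-! ### Proof terms around endomaps homotopic to the identity -/

section improvement

/-- A homotopy between `con 0` and the identity as an equivalence structure on the identity. -/
def equivOfHtpy (A f H : Hoas) : Hoas :=
  equivMk A A (idFun A) f H (idFun A) (lam A fun a => refl a)

/-- The equivalence with underlying map the identity given by `H : f ∼ id`. -/
def hEquivOfHtpy (A f H : Hoas) : Hoas := pair (hEquiv A A) (idFun A) (equivOfHtpy A f H)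

/-- The identity `f = id` obtained from a preimage of `hEquivOfHtpy A f H` in `A ≅ A`. -/
def eqIdOfPreimage (A f t P : Hoas) : Hoas :=
  let M := arr A A
  let E := app (cEquivToHEquiv A A) t
  let s := fst (fst (snd t))
  -- The chain is `f = s = id ∘ s = fst t ∘ s = id`. The section component of `P` gives the first
  -- step and its underlying map the third; the second holds judgmentally by `η`, and the last is
  -- the identification contained in `t`.
  trans M f (symm M s (ap M (fun z => fst (fst (snd z))) E P))
    (trans M s
      (ap M (fun k => comp A k s) (idFun A) (symm M (fst t) (ap M (fun z => fst z) E P)))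
      (snd (fst (snd t))))

/-- The identity is an equivalence with section `f`, by `H`, and also with section `id`; a path
between the two structures identifies the sections. -/
def eqIdOfProp (A f h H : Hoas) : Hoas :=
  let x := equivOfHtpy A f H
  ap (arr A A) (fun z => fst (fst z)) x
    (app (app h x) (equivOfHtpy A (idFun A) (lam A fun a => refl a)))

/-- The type of paths in `A`. -/
def paths (A : Hoas) : Hoas := sigma A fun x => sigma A fun y => idt A x y

/-- The annotations are the true component types, so that `constPath` is literally normal, as `isTm`
demands. -/
def pathsMk (A x y p : Hoas) : Hoas :=
  let S := sigma A fun y => idt A x y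
  fun d => .pair (paths A d) (S d) (x d) (.pair (S d) (idt A x y d) (y d) (p d))

/-- The constant path. -/
def constPath (A : Hoas) : Hoas := lam A fun x => pathsMk A x x (refl x)

/-- The source map is inverse on both sides: path induction contracts every path to the constant
path at its source, and the other composite is the identity judgmentally. -/
def constPathEquiv (A : Hoas) : Hoas :=
  let s := lam (paths A) fun z => fst z
  equivMk A (paths A) (constPath A) s
    (lam (paths A) fun z => ind (fun y p => idt (paths A) (app (constPath A) (fst z))
      (pathsMk A (fst z) y p)) (refl (app (constPath A) (fst z))) (snd (snd z)))
    s (lam A fun x => refl x)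

/-- The map `k` has source `f` and target `id`. It equals `constPath ∘ s` for some `s`, whose source
and target are both `s`; hence `f = s = id`. -/
def eqIdOfPostComp (A f h H : Hoas) : Hoas :=
  let k := lam A fun a => pathsMk A (app f a) a (app H a)
  let R := app h (constPathEquiv A)
  let s := app (fst (fst R)) k
  let x := app (postComp A A (constPath A)) s
  let e := app (snd (fst R)) k
  trans (arr A A) f
    (symm (arr A A) s (ap (arr A A) (fun u => lam A fun a => fst (app u a)) x e))
    (ap (arr A A) (fun u => lam A fun a => fst (snd (app u a))) x e)

/-- The statement that `f ∼ id` implies `f = id`. -/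
def eqIdType (A f : Hoas) : Hoas :=
  arr (htpy A (fun _ => A) f (idFun A)) (idt (arr A A) f (idFun A))

def cEqOfEquiv (A B f e p q : Hoas) : Hoas :=
  pair (isCEq A B f) (pair (cSec A B f) (fst (fst e)) (app p (snd (fst e))))
    (pair (cRet A B f) (fst (snd e)) (app q (snd (snd e))))

/-- Composition is judgmentally associative and unital, so `f ∘ (s ∘ k) = k` is the action of `u ↦ u
∘ k` on the identification `f ∘ s = id`; the retraction is treated likewise. -/
def postCompEquiv (A B Z f c : Hoas) : Hoas :=
  let s := fst (fst c)
  let r := fst (snd c)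
  equivMk (arr Z A) (arr Z B) (postComp Z A f)
    (lam (arr Z B) fun k => comp Z s k)
    (lam (arr Z B) fun k => ap (arr Z B) (fun u => comp Z u k) (comp B f s) (snd (fst c)))
    (lam (arr Z B) fun k => comp Z r k)
    (lam (arr Z A) fun k => ap (arr Z A) (fun u => comp Z u k) (comp A r f) (snd (snd c)))

end improvement

section implications

variable {X : Scheme}

theorem equivImprovementSection_of_equivImprovement (h : EquivImprovement X) :
    EquivImprovementSection X := by
  intro Γ A B hA hB
  obtain ⟨t, ht⟩ := h Γ A B hA hB
  exact ⟨_, ht.fst⟩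

theorem htpyIdToEqId_of_raw
    (h : ∀ {Γ A f}, Der X (ty Γ A) → Der X (tm Γ f (ITT.arr A A)) →
      Inhabited X Γ ((eqIdType (base 0) (con 0) 0).raw
        (.of A A A .unit f .star) 0)) : HtpyIdToEqId X := by
  intro Γ A f hA hf
  simpa [eqIdType] using h hA hf

theorem htpyIdToEqId_of_equivImprovementSection (h : EquivImprovementSection X) :
    HtpyIdToEqId X := by
  refine htpyIdToEqId_of_raw fun {Γ A f} hA hf => ?_
  have hM := valid_end hA hf
  let a := base 0
  let N := htpy a (fun _ => a) (con 0) (idFun a)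
  let S := hSec (cEquiv a a) (hEquiv a a) (cEquivToHEquiv a a)
  let Q (H t : Hoas) := idt (hEquiv a a) (app (cEquivToHEquiv a a) t) (hEquivOfHtpy a (con 0) H)
  let S₁ := pi N fun H => sigma (cEquiv a a) fun t => Q H t
  -- The preimage and its path are abstracted as variables, so that `eqIdOfPreimage` is checked
  -- apart from the terms that produce them.
  let S₂ := pi N fun H => pi (cEquiv a a) fun t => pi (Q H t) fun _ =>
    idt (arr a a) (con 0) (idFun a)
  have h₀ : Inhabited X Γ ((S 0).raw (.of A A A .unit f .star) 0) := by
    simpa [S, a] using h Γ A A hA hA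
  have h₁ : Inhabited X Γ ((S₁ 0).raw (.of A A A .unit f .star) 0) :=
    h₀.mp hM (t := lam S (fun h => lam N fun H =>
      let e := hEquivOfHtpy a (con 0) H
      pair (sigma (cEquiv a a) fun t => Q H t) (app (fst h) e) (app (snd h) e)) 0)
      (by decide +kernel)
  have h₂ : Inhabited X Γ ((S₂ 0).raw (.of A A A .unit f .star) 0) :=
    inhabited_of_hasType hM (t := lam N (fun H => lam (cEquiv a a) fun t => lam (Q H t) fun P =>
      eqIdOfPreimage a (con 0) t P) 0) (by decide +kernel)
  exact h₁.mp₂ h₂ hM (t := lam S₁ (fun u => lam S₂ fun v => lam N fun H =>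
    app (app (app v H) (fst (app u H))) (snd (app u H))) 0) (by decide +kernel)

theorem htpyIdToEqId_of_isEquivIsProp (h : IsEquivIsProp X) : HtpyIdToEqId X := by
  refine htpyIdToEqId_of_raw fun {Γ A f} hA hf => ?_
  let S := isProp (isEquiv (base 0) (base 0) (idFun (base 0)))
  have hM := valid_end hA hf
  have hid : Der X (tm Γ ITT.idFun (ITT.arr A A)) :=
    .lam hA (.var (.ctx_cons hA.context hA) (.zero _ _))
  have h' : Inhabited X Γ ((S 0).raw (.of A A A .unit f .star) 0) := by
    simpa [S] using h Γ A A _ hA hA hid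
  exact h'.mp hM
    (t := lam S (fun h => lam (htpy (base 0) (fun _ => base 0) (con 0) (idFun (base 0)))
      fun H => eqIdOfProp (base 0) (con 0) h H) 0) (by decide +kernel)

theorem htpyIdToEqId_of_isEquivPostComp (h : IsEquivPostComp X) : HtpyIdToEqId X := by
  refine htpyIdToEqId_of_raw fun {Γ A f} hA hf => ?_
  let P := paths (base 0)
  let c := constPath (base 0)
  let S := arr (isEquiv (base 0) P c)
    (isEquiv (arr (base 0) (base 0)) (arr (base 0) P) (postComp (base 0) (base 0) c))
  have hM := valid_end hA hf
  have hP := ty_of_isTy hM (Δ := []) (T := P 0) hM.ctx (by decide +kernel)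
  have hc := tm_of_isTm hM (Δ := []) (t := c 0) (T := arr (base 0) P 0) hM.ctx (by decide +kernel)
  have h' : Inhabited X Γ ((S 0).raw (.of A A A .unit f .star) 0) := by
    simpa [S] using h Γ A _ A _ hA hP hA (by simpa [ctxRaw] using hc)
  exact h'.mp hM
    (t := lam S (fun h => lam (htpy (base 0) (fun _ => base 0) (con 0) (idFun (base 0)))
      fun H => eqIdOfPostComp (base 0) (con 0) h H) 0) (by decide +kernel)

/-- The hypothesis is used in the context extended by `e : isEquiv f`, where `f ∘ s` and `r ∘ f` are
endomaps homotopic to the identity. -/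
theorem isEquivToIsCEq_of_htpyIdToEqId (h : HtpyIdToEqId X) : IsEquivToIsCEq X := by
  intro Γ A B f hA hB hf
  have hM := valid_map hA hB hB hf
  let D := normTy sigMap (isEquiv (base 0) (base 1) (con 0) 0)
  let e : Hoas := var 0
  let s := comp (base 1) (con 0) (fst (fst e))
  let r := comp (base 0) (fst (snd e)) (con 0)
  have hD := ctx_of_isTy hM (D := D) (by decide +kernel)
  have hs := tm_of_isTm hM (t := s 1) (T := arr (base 1) (base 1) 1) hD (by decide +kernel)
  have hr := tm_of_isTm hM (t := r 1) (T := arr (base 0) (base 0) 1) hD (by decide +kernel)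
  have h₁ : Inhabited X Γ ((Exp.pi D (eqIdType (base 1) s 1)).raw (.of A B B .unit f .star) 0) :=
    inhabited_pi hD (by
      simpa [eqIdType, ctxRaw] using h _ _ _ (hB.wk_ty hD) (by simpa [ctxRaw] using hs))
  have h₂ : Inhabited X Γ ((Exp.pi D (eqIdType (base 0) r 1)).raw (.of A B B .unit f .star) 0) :=
    inhabited_pi hD (by
      simpa [eqIdType, ctxRaw] using h _ _ _ (hA.wk_ty hD) (by simpa [ctxRaw] using hr))
  have h₃ := h₁.mp₂ h₂ hM (U := arr (isEquiv (base 0) (base 1) (con 0))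
    (isCEq (base 0) (base 1) (con 0)) 0)
    (t := lam (fun _ => Exp.pi D (eqIdType (base 1) s 1)) (fun p =>
      lam (fun _ => Exp.pi D (eqIdType (base 0) r 1)) fun q =>
      lam (isEquiv (base 0) (base 1) (con 0)) fun e =>
        cEqOfEquiv (base 0) (base 1) (con 0) e (app p e) (app q e)) 0) (by decide +kernel)
  simpa using h₃

theorem isEquivPostComp_of_isEquivToIsCEq (h : IsEquivToIsCEq X) : IsEquivPostComp X := by
  intro Γ A B Z f hA hB hZ hf
  have hM := valid_map hA hB hZ hf
  let S := arr (isEquiv (base 0) (base 1) (con 0)) (isCEq (base 0) (base 1) (con 0))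
  have h' : Inhabited X Γ ((S 0).raw (.of A B Z .unit f .star) 0) := by
    simpa [S] using h Γ A B f hA hB hf
  have := h'.mp hM (U := arr (isEquiv (base 0) (base 1) (con 0))
    (isEquiv (arr (base 2) (base 0)) (arr (base 2) (base 1))
      (postComp (base 2) (base 0) (con 0))) 0)
    (t := lam S (fun h => lam (isEquiv (base 0) (base 1) (con 0)) fun e =>
      postCompEquiv (base 0) (base 1) (base 2) (con 0) (app h e)) 0) (by decide +kernel)
  simpa using this

end implications

/-! ### Weak function extensionality -/

section weak

/-- The total space of the opaque family. -/
def total : Hoas := sigma (base 0) fam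

/-- The element of the total space over `a` given by `x`. -/
def totalMk (a x : Hoas) : Hoas := fun d => .pair (total d) (fam a d) (a d) (x d)

/-- Sections of the opaque family along `k`. -/
def sectionsAlong (k : Hoas) : Hoas := pi (base 0) fun a => fam (app k a)

/-- Maps to the total space, as a `Σ`-type over their first components. -/
def lifts : Hoas := sigma (arr (base 0) (base 0)) sectionsAlong

/-- The center of contraction of the opaque family at `a`, for `K` a proof that the family consists
of contractible types. -/
def center (K a : Hoas) : Hoas := fst (app K a)

/-- The endomap of the total space that retracts each fibre to its center. -/
def collapse (K : Hoas) : Hoas := lam total fun z => totalMk (fst z) (center K (fst z))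

def collapseHtpy (K : Hoas) : Hoas := lam total fun z =>
  ap total (fun u => totalMk (fst z) u) (center K (fst z)) (app (snd (app K (fst z))) (snd z))

/-- The path from the collapse of `z : lifts` to `z`, where `q : collapse = id`. -/
def collapsePath (K q z : Hoas) : Hoas :=
  let w (g : Hoas → Hoas) := lam (base 0) fun a => g (totalMk (app (fst z) a) (app (snd z) a))
  ap lifts (fun h => pair lifts (w fun x => fst (app h x)) (w fun x => snd (app h x)))
    (collapse K) q

/-- The contraction of the type of sections of the opaque family. -/
def sectionsContr (K q : Hoas) : Hoas :=
  let P := sectionsAlong (idFun (base 0))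
  let c := lam (base 0) fun a => center K a
  let z₀ := pair lifts (idFun (base 0)) c
  -- `collapsePath` at `z₁ = (id, u)` joins `(id, c)` to `(id, u)`, but its first component is a
  -- loop at `id` that need not be trivial. So it only shows that `c` transported along `loop z₁` is
  -- `u`. The remaining terms remove the loop.
  let base' (w : Hoas) := ap (arr (base 0) (base 0)) (fun z => fst z) z₀ w
  let loop (z : Hoas) := ap (arr (base 0) (base 0)) (fun z => fst z)
    (pair lifts (fst z) (lam (base 0) fun a => center K (app (fst z) a))) (collapsePath K q z)
  pair (isContr P) c (lam P fun u =>
    let z₁ := pair lifts (idFun (base 0)) u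
    let w := collapsePath K q z₁
    let tr := transport sectionsAlong
    let x := tr (loop z₀) c
    -- Moving `z₀` to `z₁` along `w`, whose first component is `loop z₁` itself, carries `loop z₀`
    -- to `loop z₁`. Hence transporting `c` along `loop z₀` and then `loop z₁` agrees with
    -- transporting it twice along `loop z₁`.
    let nat := ind (fun z w => idt (sectionsAlong (fst z)) (tr (base' w) x)
      (tr (loop z) (tr (base' w) c))) (refl x) w
    let dep (w : Hoas) := ind (fun z w => idt (sectionsAlong (fst z)) (tr (base' w) c) (snd z))
      (refl c) w
    -- Transport along a path is injective, so the outer transport along `loop z₁` in `nat` cancels.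
    let inj := ind (fun k m => pi P fun x => pi P fun y =>
        arr (idt (sectionsAlong k) (tr m x) (tr m y)) (idt P x y))
      (lam P fun x => lam P fun y => lam (idt P x y) fun p => p) (loop z₁)
    let y := tr (loop z₁) c
    -- The chain is `c = x = y = u`, where `x` and `y` are the transports of `c` along `loop z₀` and
    -- `loop z₁`. The outer steps are `dep` for `z₀` and for `z₁`.
    trans P c (symm P x (dep (collapsePath K q z₀)))
      (trans P x (app (app (app inj x) y) nat) (dep w)))

end weak

/-! ### Function extensionality from products of singletons -/

section funext

/-- The type of elements of the fibre of the opaque family that are equal to `f a`. -/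
def singleton (f a : Hoas) : Hoas := sigma (fam a) fun x => idt (fam a) (app f a) x

def singletonMk (f a x p : Hoas) : Hoas :=
  fun d => .pair (singleton f a d) (idt (fam a) (app f a) x d) (x d) (p d)

def singletonContr (f a : Hoas) : Hoas :=
  pair (isContr (singleton f a)) (singletonMk f a (app f a) (refl (app f a)))
    (lam (singleton f a) fun z => ind (fun x p => idt (singleton f a)
      (singletonMk f a (app f a) (refl (app f a))) (singletonMk f a x p))
      (refl (singletonMk f a (app f a) (refl (app f a)))) (snd z))

/-- Function extensionality at `f` and `g`, where `W` is a contraction of the product of the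
types `singleton f a`. -/
def happlyEquiv (f g W : Hoas) : Hoas :=
  let S := pi (base 0) fam
  let P := pi (base 0) fun a => singleton f a
  let pt (g H : Hoas) := lam (base 0) fun a => singletonMk f a (app g a) (app H a)
  let ρ := lam (base 0) fun a => refl (app f a)
  let k (u : Hoas) := app (snd W) u
  let F (u : Hoas) := lam (base 0) fun a => fst (app u a)
  -- A point of `P` is a map `g` with a homotopy `H : f ∼ g`. The path from `(f, ρ)` to `(g, H)`
  -- runs through the center, so at `(f, ρ)` it has the form `p⁻¹ · p` and `triv` makes its image
  -- under `F` reflexivity.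
  let path (g H : Hoas) := cmp P (k (pt f ρ)) (k (pt g H)) (pt g H)
  let s (g H : Hoas) := ap S F (pt f ρ) (path g H)
  let hap (g : Hoas) := happly (base 0) fam f g
  let N := htpy (base 0) fam f g
  -- For any path from `(f, ρ)` to `u`, `happly` of its first component is the second component of
  -- `u`, by induction on the path.
  let sec := ind (fun u w => idt (htpy (base 0) fam f (F u)) (app (hap (F u)) (ap S F (pt f ρ) w))
    (lam (base 0) fun a => snd (app u a))) (refl ρ)
  let triv := ind (fun u w => idt (idt S (F u) (F u)) (ap S F u (cmp P w w u)) (refl (F u)))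
    (refl (refl (F (fst W)))) (k (pt f ρ))
  let inv := lam N fun H => s g H
  equivMk (idt S f g) N (hap g) inv (lam N fun H => sec (path g H))
    inv (lam (idt S f g) fun p => ind (fun g p => idt (idt S f g) (s g (app (hap g) p)) p) triv p)

end funext

section implications

variable {X : Scheme}

theorem weakFunExt_of_htpyIdToEqId (h : HtpyIdToEqId X) : WeakFunExt X := by
  intro Γ A P hA hP
  have hM := valid_fam hA hP
  let S := pi (base 0) fun a => isContr (fam a)
  let D := normTy (sig none none) (S 0)
  have hD := ctx_of_isTy hM (D := D) (by decide +kernel)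
  have ht := ty_of_isTy hM hD (T := total 1) (by decide +kernel)
  have hr := tm_of_isTm hM (t := collapse (var 0) 1) (T := arr total total 1) hD
    (by decide +kernel)
  have h₀ : Inhabited X Γ ((Exp.pi D (eqIdType total (collapse (var 0)) 1)).raw
      (.of A A A P .star .star) 0) :=
    inhabited_pi hD (by
      have e := raw_wk (.of A A A P .star .star) (total 1) 1
      simpa [eqIdType, ctxRaw, ← e, Exp.wk] using! h _ _ _ ht (by simpa [ctxRaw] using hr))
  have h₁ : Inhabited X Γ ((pi S (fun K => idt (arr total total) (collapse K) (idFun total)) 0).raw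
      (.of A A A P .star .star) 0) :=
    h₀.mp hM (t := lam (fun _ => Exp.pi D (eqIdType total (collapse (var 0)) 1)) (fun h =>
      lam S fun K => app (app h K) (collapseHtpy K)) 0) (by decide +kernel)
  have h₂ := h₁.mp hM (U := arr S (isContr (pi (base 0) fam)) 0)
    (t := lam (pi S (fun K => idt (arr total total) (collapse K) (idFun total))) (fun h =>
      lam S fun K => sectionsContr K (app h K)) 0) (by decide +kernel)
  simpa [S] using h₂

theorem funExt_of_weakFunExt (h : WeakFunExt X) : FunExt X := by
  intro Γ A B f g hA hB hf hg
  have hM := valid_sections hA hB hf hg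
  let a := base 0
  have hD := ctx_of_isTy hM (D := .base 0) (by decide +kernel)
  have hP := ty_of_isTy hM hD (T := singleton (con 0) (var 0) 1) (by decide +kernel)
  let S := arr (pi a fun x => isContr (singleton (con 0) x)) (isContr (pi a (singleton (con 0))))
  have h₀ : Inhabited X Γ ((S 0).raw (.of A A A B f g) 0) := by
    simpa [S, a, ctxRaw] using h Γ A _ hA (by simpa [ctxRaw] using hP)
  have h₁ := h₀.mp hM (U := isEquiv (idt (pi a fam) (con 0) (con 1)) (htpy a fam (con 0) (con 1))
      (happly a fam (con 0) (con 1)) 0)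
    (t := lam S (fun h => happlyEquiv (con 0) (con 1)
      (app h (lam a fun x => singletonContr (con 0) x))) 0) (by decide +kernel)
  simpa [a] using h₁

end implications

/-- The statement that `happly` is an equivalence for all pairs `(u, id)` of endomaps of `A`. -/
def happlyIdEquiv (A : Hoas) : Hoas := pi (arr A A) fun u =>
  isEquiv (idt (arr A A) u (idFun A)) (htpy A (fun _ => A) u (idFun A))
    (happly A (fun _ => A) u (idFun A))

/-! ### Equivalence improvement from function extensionality -/

section improvement

/-- The categorical equivalence with the maps of `e` and the paths `x`, `y`. -/
def cEquivMk (A B e x y : Hoas) : Hoas :=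
  let f := fst e
  pair (cEquiv A B) f (pair (isCEq A B f) (pair (cSec A B f) (fst (fst (snd e))) x)
    (pair (cRet A B f) (fst (snd (snd e))) y))

/-- The homotopy equivalence with the maps of `e` and the homotopies `x`, `y`. -/
def hEquivMk (A B e x y : Hoas) : Hoas :=
  pair (hEquiv A B) (fst e) (equivMk A B (fst e) (fst (fst (snd e))) x (fst (snd (snd e))) y)

/-- The map `(A ≅ B) → (A ≃ B)` as an equivalence, where `p` and `q` prove that `happly` is an
equivalence for endomaps of `B` and of `A`. -/
def improvementEquiv (A B p q : Hoas) : Hoas :=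
  let u (e : Hoas) := comp B (fst e) (fst (fst (snd e)))
  let v (e : Hoas) := comp A (fst (snd (snd e))) (fst e)
  let x (e : Hoas) := snd (fst (snd e))
  let y (e : Hoas) := snd (snd (snd e))
  let hB (e z : Hoas) := app (happly B (fun _ => B) (u e) (idFun B)) z
  let hA (e z : Hoas) := app (happly A (fun _ => A) (v e) (idFun A)) z
  let sB (e : Hoas) := app (fst (fst (app p (u e)))) (x e)
  let sA (e : Hoas) := app (fst (fst (app q (v e)))) (y e)
  let rB (e z : Hoas) := app (fst (snd (app p (u e)))) z
  let rA (e z : Hoas) := app (fst (snd (app q (v e)))) z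
  -- The three maps stay fixed and `happly` acts on the other two components, so its section and
  -- retraction apply componentwise. The paths change one component at a time.
  equivMk (cEquiv A B) (hEquiv A B) (cEquivToHEquiv A B)
    (lam (hEquiv A B) fun e => cEquivMk A B e (sB e) (sA e))
    (lam (hEquiv A B) fun e => trans (hEquiv A B) (hEquivMk A B e (hB e (sB e)) (hA e (sA e)))
      (ap (hEquiv A B) (fun z => hEquivMk A B e z (hA e (sA e))) (hB e (sB e))
        (app (snd (fst (app p (u e)))) (x e)))
      (ap (hEquiv A B) (fun z => hEquivMk A B e (x e) z) (hA e (sA e))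
        (app (snd (fst (app q (v e)))) (y e))))
    (lam (hEquiv A B) fun e => cEquivMk A B e (rB e (x e)) (rA e (y e)))
    (lam (cEquiv A B) fun c =>
      let x' := rB c (hB c (x c))
      let y' := rA c (hA c (y c))
      trans (cEquiv A B) (cEquivMk A B c x' y')
        (ap (cEquiv A B) (fun z => cEquivMk A B c z y') x'
          (app (snd (snd (app p (u c)))) (x c)))
        (ap (cEquiv A B) (fun z => cEquivMk A B c (x c) z) y'
          (app (snd (snd (app q (v c)))) (y c))))

end improvement

/-! ### Contractible fibres of invertible maps -/

section fibers

/-- The fibre of `e : A → B` over `y`. -/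
def fiber (A B : Hoas) (e : Hoas → Hoas) (y : Hoas) : Hoas := sigma A fun x => idt B (e x) y

/-- The contraction of the fibre over `y` of a map `e` with homotopy inverse `g`, where
`η x : g (e x) = x` and `ε y : e (g y) = y`. -/
def fiberContr (A B : Hoas) (e g η ε : Hoas → Hoas) (y : Hoas) : Hoas :=
  let F := fiber A B e y
  let cj (v a u' b m : Hoas) :=
    ind (fun v' _ => idt B u' v') (ind (fun u' _ => idt B u' v) m a) b
  let div (x₀ h x₂ k : Hoas) := trans A x₀ h (symm A x₂ k)
  -- The maps `φ` and `θ` exhibit the fibre `Σ x, e x = y` as a retract of the singleton `Σ x, g y =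
  -- x`. No triangle identity between `η` and `ε` is needed: `θ` is `ε⁻¹ · e(η · k⁻¹) · ε`.
  let φ (x p : Hoas) := ind (fun y _ => idt A (g y) x) (η x) p
  let θ (y x k : Hoas) := cj (e (g y)) (ε (e x)) (e x) (ε y)
    (ap B e (g (e x)) (div (g (e x)) (η x) (g y) k))
  let c := pair F (g y) (θ y (g y) (refl (g y)))
  pair (isContr F) c (lam F fun z =>
    let x := fst z
    let x₀ := g (e x)
    let ε₀ := ε (e x)
    -- For `p = refl`, `φ x p` is `η x` and `θ` becomes `ε₀⁻¹ · e(η · η⁻¹) · ε₀`. It collapses by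
    -- induction on `η x`, with `ε₀` and the outer `e x` held fixed, and then on `ε₀`.
    let coh₀ := ind (fun w m => idt (idt B w w) (cj (e x₀) m w m (refl (e x₀))) (refl w))
      (refl (refl (e x₀))) ε₀
    let coh₁ := ind (fun _ h => idt (idt B (e x) (e x))
      (cj (e x₀) ε₀ (e x) ε₀ (ap B e x₀ (div x₀ h x₀ h))) (refl (e x))) coh₀ (η x)
    let coh := ind (fun y p => idt (idt B (e x) y) (θ y x (φ x p)) p) coh₁ (snd z)
    let k := φ x (snd z)
    trans F c (ind (fun x k => idt F c (pair F x (θ y x k))) (refl c) k)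
      (ap F (fun t => pair F x t) (θ y x k) coh))

end fibers

section implications

variable {X : Scheme} {Γ : Ctx} {A : Raw}

/-- The endomap is quantified inside the theory by using the principle with a fresh variable; the
statement can then be applied to composites built from bound variables. -/
theorem inhabited_happlyIdEquiv (h : FunExt X) (hA : Der X (ty Γ A)) :
    Inhabited X Γ (.pi (ITT.arr A A) (ITT.isEquiv (.idt (ITT.arr A.wk A.wk) (.var 0) ITT.idFun)
      (ITT.htpy A.wk A.wk.wk (.var 0) ITT.idFun) (ITT.happly A.wk A.wk.wk (.var 0)))) := by
  have hC : Der X (ty Γ (ITT.arr A A)) := arr_form hA hA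
  have hΓ := Der.ctx_cons hA.context hC
  have hA' := hA.wk_ty hΓ
  have hΓ' := Der.ctx_cons hΓ hA'
  have hv : Der X (tm (ITT.arr A A :: Γ) (.var 0) (ITT.arr A.wk A.wk)) := by
    have e : (ITT.arr A A).wk = ITT.arr A.wk A.wk := by
      simp only [ITT.arr, Raw.wk, Raw.rename, Raw.rename_rename]
      rfl
    exact e ▸ Der.var hΓ (.zero _ _)
  obtain ⟨t, ht⟩ := h _ _ _ (.var 0) ITT.idFun hA' (hA'.wk_ty hΓ') hv
    (.lam hA' (.var hΓ' (.zero _ _)))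
  exact ⟨_, .lam hC ht⟩

theorem equivImprovement_of_funExt (h : FunExt X) : EquivImprovement X := by
  intro Γ A B hA hB
  have hM := valid_types hA hB
  let a := base 0
  let b := base 1
  have h₀ : Inhabited X Γ ((happlyIdEquiv b 0).raw (.of A B B .unit .star .star) 0) := by
    simpa [happlyIdEquiv, b] using inhabited_happlyIdEquiv h hB
  have h₁ : Inhabited X Γ ((happlyIdEquiv a 0).raw (.of A B B .unit .star .star) 0) := by
    simpa [happlyIdEquiv, a] using inhabited_happlyIdEquiv h hA
  have h₂ := h₀.mp₂ h₁ hM (U := isEquiv (cEquiv a b) (hEquiv a b) (cEquivToHEquiv a b) 0)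
    (t := lam (happlyIdEquiv b) (fun p => lam (happlyIdEquiv a) fun q =>
      improvementEquiv a b p q) 0) (by decide +kernel)
  simpa [a, b] using h₂

end implications

/-! ### Being an equivalence is a proposition -/

section proposition

/-- The type of two-sided inverses of `f` up to identity. -/
def inverses (A B f : Hoas) : Hoas := sigma (arr B A) fun g =>
  sigma (idt (arr B B) (comp B f g) (idFun B)) fun _ => idt (arr A A) (comp A g f) (idFun A)

/-- The two-sided inverse of `f` given by `e : isEquiv f`, where `p` and `q` prove that `happly`
is an equivalence for endomaps of `B` and of `A`. -/
def inverseOfEquiv (A B f e p q : Hoas) : Hoas :=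
  let g := fst (fst e)
  let r := fst (snd e)
  let u := comp B f g
  let v := comp A g f
  let η (x : Hoas) := app (snd (snd e)) x
  let rf (x : Hoas) := app r (app f x)
  let gf (x : Hoas) := app g (app f x)
  pair (inverses A B f) g
    (pair (sigma (idt (arr B B) u (idFun B)) fun _ => idt (arr A A) v (idFun A))
      (app (fst (fst (app p u))) (snd (fst e)))
      -- The section is also a left inverse: `g (f x) = r (f (g (f x))) = r (f x) = x`.
      (app (fst (fst (app q v))) (lam A fun x =>
        trans A (gf x) (symm A (rf (gf x)) (η (gf x)))
          (trans A (rf (gf x)) (ap A (fun y => app r y) (app f (gf x))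
            (app (snd (fst e)) (app f x))) (η x)))))

/-- The contraction of the type of sections of `f`, where `i` is an inverse of `f`. -/
def cSecContr (A B f i : Hoas) : Hoas :=
  let g := fst i
  fiberContr (arr B A) (arr B B) (fun k => comp B f k) (fun k => comp B g k)
    (fun k => ap (arr B A) (fun u => comp B u k) (comp A g f) (snd (snd i)))
    (fun k => ap (arr B B) (fun u => comp B u k) (comp B f g) (fst (snd i))) (idFun B)

/-- The contraction of the type of retractions of `f`, where `i` is an inverse of `f`. -/
def cRetContr (A B f i : Hoas) : Hoas :=
  let g := fst i
  fiberContr (arr B A) (arr A A) (fun k => comp A k f) (fun k => comp B k g)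
    (fun k => ap (arr B A) (fun u => comp B k u) (comp B f g) (fst (snd i)))
    (fun k => ap (arr A A) (fun u => comp A k u) (comp A g f) (snd (snd i))) (idFun A)

/-- The contraction of `Σ k, w k ∼ id` given by a contraction `K` of `Σ k, w k = id`, where `p`
proves that `happly` is an equivalence for endomaps of `A`. -/
def htpyContr (T A : Hoas) (w : Hoas → Hoas) (p K : Hoas) : Hoas :=
  let S := sigma T fun k => htpy A (fun _ => A) (w k) (idFun A)
  let C := sigma T fun k => idt (arr A A) (w k) (idFun A)
  let hap (k x : Hoas) := app (happly A (fun _ => A) (w k) (idFun A)) x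
  let sec (k x : Hoas) := app (fst (fst (app p (w k)))) x
  let ψ (z : Hoas) := pair S (fst z) (hap (fst z) (snd z))
  let φ (z : Hoas) := pair C (fst z) (sec (fst z) (snd z))
  -- `ψ ∘ φ ∼ id` because `sec` is a section of `happly`, so `S` is a retract of the contractible
  -- type `C`.
  pair (isContr S) (ψ (fst K)) (lam S fun z =>
    trans S (ψ (fst K)) (ap S ψ (fst K) (app (snd K) (φ z)))
      (ap S (fun h => pair S (fst z) h) (hap (fst z) (sec (fst z) (snd z)))
        (app (snd (fst (app p (w (fst z))))) (snd z))))

/-- The path in `S × T` between `x` and `y` given by contractions of `S` and of `T`. -/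
def prodPath (S T H K x y : Hoas) : Hoas :=
  let P := sigma S fun _ => T
  let p (K T x y : Hoas) := cmp T (app (snd K) x) (app (snd K) y) y
  trans P x (ap P (fun u => pair P u (snd x)) (fst x) (p H S (fst x) (fst y)))
    (ap P (fun u => pair P (fst y) u) (snd x) (p K T (snd x) (snd y)))

end proposition

section implications

variable {X : Scheme}

/-- To compare two elements of `isEquiv f`, `f` may be assumed invertible up to identity. Its
sections and retractions up to identity then form contractible types, `happly` carries this over to
homotopies, and any two elements of a product of contractible types are equal. -/
theorem isEquivIsProp_of_funExt (h : FunExt X) : IsEquivIsProp X := by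
  intro Γ A B f hA hB hf
  have hM := valid_map hA hB hB hf
  let a := base 0
  let b := base 1
  let f₀ := con 0
  let E := isEquiv a b f₀
  let I := inverses a b f₀
  have hb : Inhabited X Γ ((happlyIdEquiv b 0).raw (.of A B B .unit f .star) 0) := by
    simpa [happlyIdEquiv, b] using inhabited_happlyIdEquiv h hB
  have ha : Inhabited X Γ ((happlyIdEquiv a 0).raw (.of A B B .unit f .star) 0) := by
    simpa [happlyIdEquiv, a] using inhabited_happlyIdEquiv h hA
  have hi : Inhabited X Γ ((arr E I 0).raw (.of A B B .unit f .star) 0) :=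
    hb.mp₂ ha hM (t := lam (happlyIdEquiv b) (fun p => lam (happlyIdEquiv a) fun q =>
      lam E fun e => inverseOfEquiv a b f₀ e p q) 0) (by decide +kernel)
  have hs₁ : Inhabited X Γ ((arr I (isContr (cSec a b f₀)) 0).raw
      (.of A B B .unit f .star) 0) :=
    inhabited_of_hasType hM (t := lam I (fun i => cSecContr a b f₀ i) 0) (by decide +kernel)
  have hr₁ : Inhabited X Γ ((arr I (isContr (cRet a b f₀)) 0).raw
      (.of A B B .unit f .star) 0) :=
    inhabited_of_hasType hM (t := lam I (fun i => cRetContr a b f₀ i) 0) (by decide +kernel)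
  have hs : Inhabited X Γ ((arr I (isContr (hSec a b f₀)) 0).raw (.of A B B .unit f .star) 0) :=
    hs₁.mp₂ hb hM (t := lam (arr I (isContr (cSec a b f₀))) (fun c => lam (happlyIdEquiv b)
      fun p => lam I fun i => htpyContr (arr b a) b (fun k => comp b f₀ k) p (app c i)) 0)
      (by decide +kernel)
  have hr : Inhabited X Γ ((arr I (isContr (hRet a b f₀)) 0).raw (.of A B B .unit f .star) 0) :=
    hr₁.mp₂ ha hM (t := lam (arr I (isContr (cRet a b f₀))) (fun c => lam (happlyIdEquiv a)
      fun p => lam I fun i => htpyContr (arr b a) a (fun k => comp a k f₀) p (app c i)) 0)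
      (by decide +kernel)
  have hc : Inhabited X Γ ((arr I (isProp E) 0).raw (.of A B B .unit f .star) 0) :=
    hs.mp₂ hr hM (t := lam (arr I (isContr (hSec a b f₀))) (fun c =>
      lam (arr I (isContr (hRet a b f₀))) fun d => lam I fun i => lam E fun x => lam E fun y =>
        prodPath (hSec a b f₀) (hRet a b f₀) (app c i) (app d i) x y) 0) (by decide +kernel)
  have := hi.mp₂ hc hM (U := isProp E 0) (t := lam (arr E I) (fun i => lam (arr I (isProp E))
    fun c => lam E fun x => lam E fun y => app (app (app c (app i y)) x) y) 0) (by decide +kernel)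
  simpa [E, a, b, f₀] using this

end implications

end Hoas

end ITT

theorem mainTheorem3 (X : ITT.Scheme) :
    List.TFAE
      [ITT.EquivImprovement X,
       ITT.EquivImprovementSection X,
       ITT.IsEquivIsProp X,
       ITT.HtpyIdToEqId X,
       ITT.IsEquivToIsCEq X,
       ITT.IsEquivPostComp X,
       ITT.WeakFunExt X,
       ITT.FunExt X] := by
  tfae_have 1 → 2 := ITT.Hoas.equivImprovementSection_of_equivImprovement
  tfae_have 2 → 4 := ITT.Hoas.htpyIdToEqId_of_equivImprovementSection
  tfae_have 3 → 4 := ITT.Hoas.htpyIdToEqId_of_isEquivIsProp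
  tfae_have 4 → 5 := ITT.Hoas.isEquivToIsCEq_of_htpyIdToEqId
  tfae_have 5 → 6 := ITT.Hoas.isEquivPostComp_of_isEquivToIsCEq
  tfae_have 6 → 4 := ITT.Hoas.htpyIdToEqId_of_isEquivPostComp
  tfae_have 4 → 7 := ITT.Hoas.weakFunExt_of_htpyIdToEqId
  tfae_have 7 → 8 := ITT.Hoas.funExt_of_weakFunExt
  tfae_have 8 → 1 := ITT.Hoas.equivImprovement_of_funExt
  tfae_have 8 → 3 := ITT.Hoas.isEquivIsProp_of_funExt
  tfae_finish
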